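/- **ZX-diagrams.** Diagrams $a\to b$ ($a$ inputs, $b$ outputs, read from top to bottom) are generated under sequential composition and $\otimes$ by green spiders $Z^{(n,m)}_\alpha$, red spiders $X^{(n,m)}_\alpha$ ($\alpha\in\mathbb R/2\pi\mathbb Z$), the triangle $T:1\to1$, the wire, the cup $2\to0$, the cap $0\to2$, the swap and the empty diagram. Their standard interpretations are $|0\rangle^{\otimes m}\langle0|^{\otimes n}+e^{i\alpha}|1\rangle^{\otimes m}\langle1|^{\otimes n}$ for $Z^{(n,m)}_\alpha$, the same with $|\pm\rangle$ for $X^{(n,m)}_\alpha$, and $\begin{pmatrix}1&1\\0&1\end{pmatrix}$ for $T$. Write $T^{-1}$ for $T$ between two green phases $\pi$, and $\mathrm{AND}_k:k\to1$ for $T^{\otimes k}$ followed by $Z^{(k,1)}_0$ and $T^{-1}$. **Gadgets.** The phase gadget of phase $\theta$ on a set $S$ of lines has a green spider on every line of $S$, each joined to one common phaseless red spider, which is joined to a green dot $Z^{(1,0)}_\theta$. The $k$-AND plugged with phase $\theta$ on $S$, $|S|=k$, is obtained by replacing the red spider with $\mathrm{AND}_k$. **Rules.** Two diagrams are derivably equal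 if they are related by the smallest congruence that contains the laws of a compact closed strict symmetric monoidal category, the irrelevance of the order of the legs of a spider, the equality with the empty diagram of every scalar diagram $0\to0$ with non-zero interpretation (non-zero scalars are ignored), and the following rules. 1. In both colour versions: spider fusion along at least one wire; a phaseless spider with two legs is a wire, cap or cup; a spider copies the states $X^{(0,1)}_\kappa$, $\kappa\in\{0,\pi\}$, of the other colour (written here for a green spider); the bialgebra rule; a phase $\pi$ passes through a spider $Z^{(1,m)}_\alpha$ of the other colour, turning $\alpha$ into $-\alpha$. 2. For the triangle: $T$ sends $X^{(0,1)}_0$ to $X^{(0,1)}_0$ and $X^{(0,1)}_\pi$ to $Z^{(0,1)}_0$; $T\circ T^{-1}$ is the wire; the transpose of $T$ is $T$ between two red phases $\pi$. 3. For AND: it distributes over XOR $=X^{(2,1)}_0$; it is idempotent, $\mathrm{AND}_2\circ Z^{(1,2)}_0=$ wire; it commutes with copying, i.e. is a homomorphism for $Z^{(1,2)}_0$. 4. For every $\alpha\in[0,2\pi)$: the phase gadget of phase $-\alpha/2$ on three lines equals the composite of a green phase $-\alpha/2$ on each line, a 2-AND plugged with phase $\alpha$ on each pair of lines, and a 3-AND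 plugged with phase $-2\alpha$ on the three lines. **Statement.** Let $n\ge3$. The $\pi/4$-phase gadget on $n$ lines is derivably equal to the composite, in any order, of * a 1-line phase gadget of phase $\sigma=\frac{(n-2)(n-3)\pi}{8}$ on each of the $n$ lines, * a 2-line phase gadget of phase $\tau=\frac{(3-n)\pi}{4}$ on each pair of the $n$ lines, * a 3-line phase gadget of phase $\frac{\pi}{4}$ on each triple of the $n$ lines. -/

import Mathlib

namespace ZX

/-- The two colours of spiders: `green` spiders are the `Z`-spiders and `red` spiders are the
`X`-spiders. -/
inductive Colour : Type
  | green : Colour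
  | red : Colour

/-- The other colour. -/
def Colour.swap : Colour → Colour
  | Colour.green => Colour.red
  | Colour.red => Colour.green

/-- ZX-diagrams `a → b` (with `a` inputs and `b` outputs), generated from the elementary diagrams by
sequential composition `comp` (first the left diagram, then the right one, i.e. reading from top to
bottom) and parallel composition `tensor`.  Phases are elements of `ℝ / 2πℤ`. -/
inductive Diagram : ℕ → ℕ → Type
  | spider (c : Colour) (n m : ℕ) (α : Real.Angle) : Diagram n m
  | triangle : Diagram 1 1
  | wire : Diagram 1 1
  | cup : Diagram 2 0
  | cap : Diagram 0 2
  | swap : Diagram 2 2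
  | empty : Diagram 0 0
  | comp {a b c : ℕ} (D : Diagram a b) (E : Diagram b c) : Diagram a c
  | tensor {a b c d : ℕ} (D : Diagram a b) (E : Diagram c d) : Diagram (a + c) (b + d)

end ZX

infixl:65 " ⨾ " => ZX.Diagram.comp
infixl:75 " ⊠ " => ZX.Diagram.tensor

namespace ZX

namespace Diagram

/-- Transport of a diagram along equalities of the numbers of inputs and outputs (needed because
`(a + b) + c` and `a + (b + c)` are equal, but not syntactically the same number). -/
def cast {a b a' b' : ℕ} (ha : a = a') (hb : b = b') (D : Diagram a b) : Diagram a' b' :=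
  ha ▸ hb ▸ D

/-- The green spider with `n` inputs, `m` outputs and phase `α`. -/
abbrev Z (n m : ℕ) (α : Real.Angle) : Diagram n m := spider Colour.green n m α

/-- The red spider with `n` inputs, `m` outputs and phase `α`. -/
abbrev X (n m : ℕ) (α : Real.Angle) : Diagram n m := spider Colour.red n m α

/-- `k` parallel copies of a one-input, one-output diagram. -/
def power (D : Diagram 1 1) : (k : ℕ) → Diagram k k
  | 0 => empty
  | k + 1 => power D k ⊠ D

/-- `n` parallel wires. -/
def wires (n : ℕ) : Diagram n n := power wire n

/-- The last of `n + 1` wires is moved across the others to the first place. -/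
def slide : (n : ℕ) → Diagram (n + 1) (1 + n)
  | 0 => wire
  | n + 1 => @tensor n n 2 2 (wires n) swap ⨾ @tensor (n + 1) (1 + n) 1 1 (slide n) wire

/-- The swap of the two middle wires out of four. -/
def middleSwap : Diagram 4 4 := @tensor 3 3 1 1 (@tensor 1 1 2 2 wire swap) wire

/-- The transpose of the triangle (the upside-down triangle), by bending wires. -/
def triangleT : Diagram 1 1 :=
  @tensor 1 1 0 2 wire cap ⨾ @tensor 2 2 1 1 (wire ⊠ triangle) wire ⨾ @tensor 2 0 1 1 cup wire

/-- The inverse of the triangle: the triangle between two green phases `π`. -/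
noncomputable def triangleInv : Diagram 1 1 :=
  Z 1 1 (Real.pi : Real.Angle) ⨾ triangle ⨾ Z 1 1 (Real.pi : Real.Angle)

/-- The `k`-input AND gate. -/
noncomputable def and (k : ℕ) : Diagram k 1 :=
  power triangle k ⨾ Z k 1 0 ⨾ triangleInv

/-- The standard interpretation of a diagram `a → b` as a matrix, with rows and columns indexed by
the bit strings of length `b` and `a` (`false` stands for `|0⟩` and `true` for `|1⟩`).  The entry of
the red spider is that of `|+⟩^{⊗ m} ⟨+|^{⊗ n} + e^{iα} |-⟩^{⊗ m} ⟨-|^{⊗ n}`. -/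
noncomputable def interp :
    {a b : ℕ} → Diagram a b → Matrix (Fin b → Bool) (Fin a → Bool) ℂ
  | _, _, spider Colour.green _ _ α => fun o i =>
      (if (∀ j, o j = false) ∧ (∀ j, i j = false) then 1 else 0) +
      (if (∀ j, o j = true) ∧ (∀ j, i j = true) then (α.toCircle : ℂ) else 0)
  | _, _, spider Colour.red n m α => fun o i =>
      ((Real.sqrt 2 : ℝ) : ℂ)⁻¹ ^ (n + m) *
        (1 + (α.toCircle : ℂ) *
          ((∏ j, if o j = true then (-1 : ℂ) else 1) * ∏ j, if i j = true then (-1 : ℂ) else 1))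
  | _, _, triangle => fun o i => if o 0 = true ∧ i 0 = false then 0 else 1
  | _, _, wire => fun o i => if o 0 = i 0 then 1 else 0
  | _, _, cup => fun _ i => if i 0 = i 1 then 1 else 0
  | _, _, cap => fun o _ => if o 0 = o 1 then 1 else 0
  | _, _, swap => fun o i => if o 0 = i 1 ∧ o 1 = i 0 then 1 else 0
  | _, _, empty => fun _ _ => 1
  | _, _, comp D E => interp E * interp D
  | _, _, @tensor a b c d D E => fun o i =>
      interp D (fun j => o (Fin.castAdd d j)) (fun j => i (Fin.castAdd c j)) *
        interp E (fun j => o (Fin.natAdd b j)) (fun j => i (Fin.natAdd a j))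

/-- The number of selected lines. -/
def legCount : (n : ℕ) → (Fin n → Bool) → ℕ
  | 0, _ => 0
  | n + 1, s => legCount n (fun i => s i.castSucc) + (s (Fin.last n)).toNat

/-- One line, which has a green spider with one extra leg to its right if it is selected. -/
noncomputable def tap : (b : Bool) → Diagram 1 (1 + b.toNat)
  | true => Z 1 2 0
  | false => wire

/-- `n` lines, with a green spider on each selected line; the extra legs of these spiders are
brought, in the order of the lines, to the right of all the lines. -/
noncomputable def legs : (n : ℕ) → (s : Fin n → Bool) → Diagram n (n + legCount n s)
  | 0, _ => empty
  | n + 1, s =>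
      cast rfl
          (show n + legCount n (fun i => s i.castSucc) + (1 + (s (Fin.last n)).toNat) =
            n + (legCount n (fun i => s i.castSucc) + 1) + (s (Fin.last n)).toNat by omega)
          (legs n (fun i => s i.castSucc) ⊠ tap (s (Fin.last n))) ⨾
        cast rfl
          (show n + (1 + legCount n (fun i => s i.castSucc)) + (s (Fin.last n)).toNat =
            n + 1 + (legCount n (fun i => s i.castSucc) + (s (Fin.last n)).toNat) by omega)
          (wires n ⊠ slide (legCount n (fun i => s i.castSucc)) ⊠ wires (s (Fin.last n)).toNat)

/-- The phase gadget of phase `θ` on the lines in `S`, among `n` lines: a green spider on every line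
in `S`, each joined to one common phaseless red spider, which is joined to a green dot of
phase `θ`. -/
noncomputable def phaseGadget {n : ℕ} (S : Finset (Fin n)) (θ : Real.Angle) : Diagram n n :=
  legs n (fun i => decide (i ∈ S)) ⨾
    (wires n ⊠ (X (legCount n (fun i => decide (i ∈ S))) 1 0 ⨾ Z 1 0 θ))

/-- The AND gate plugged with the phase `θ` on the lines in `S`, among `n` lines: a green spider on
every line in `S`, each joined to an input of one AND gate, whose output is joined to a green dot of
phase `θ`. -/
noncomputable def phaseAnd {n : ℕ} (S : Finset (Fin n)) (θ : Real.Angle) : Diagram n n :=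
  legs n (fun i => decide (i ∈ S)) ⨾
    (wires n ⊠ (and (legCount n (fun i => decide (i ∈ S))) ⨾ Z 1 0 θ))

/-- Sequential composition of a list of diagrams on `n` lines. -/
def sequence {n : ℕ} (L : List (Diagram n n)) : Diagram n n :=
  L.foldr comp (wires n)

end Diagram

open Diagram

/-- `Derivable D E`: the equation `D = E` is derivable in the ZX-calculus, non-zero scalars being
ignored. -/
inductive Derivable : {a b : ℕ} → Diagram a b → Diagram a b → Prop
  -- `Derivable` is a congruence
  | refl {a b : ℕ} (D : Diagram a b) : Derivable D D
  | symm {a b : ℕ} {D E : Diagram a b} : Derivable D E → Derivable E D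
  | trans {a b : ℕ} {D E F : Diagram a b} : Derivable D E → Derivable E F → Derivable D F
  | comp_congr {a b c : ℕ} {D D' : Diagram a b} {E E' : Diagram b c} :
      Derivable D D' → Derivable E E' → Derivable (D ⨾ E) (D' ⨾ E')
  | tensor_congr {a b c d : ℕ} {D D' : Diagram a b} {E E' : Diagram c d} :
      Derivable D D' → Derivable E E' → Derivable (D ⊠ E) (D' ⊠ E')
  -- strict monoidal category
  | comp_assoc {a b c d : ℕ} (D : Diagram a b) (E : Diagram b c) (F : Diagram c d) :
      Derivable (D ⨾ E ⨾ F) (D ⨾ (E ⨾ F))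
  | wires_comp {a b : ℕ} (D : Diagram a b) : Derivable (wires a ⨾ D) D
  | comp_wires {a b : ℕ} (D : Diagram a b) : Derivable (D ⨾ wires b) D
  | tensor_assoc {a b c d e f : ℕ} (D : Diagram a b) (E : Diagram c d) (F : Diagram e f) :
      Derivable (D ⊠ E ⊠ F)
        (cast (Nat.add_assoc a c e).symm (Nat.add_assoc b d f).symm (D ⊠ (E ⊠ F)))
  | empty_tensor {a b : ℕ} (D : Diagram a b) :
      Derivable (empty ⊠ D) (cast (Nat.zero_add a).symm (Nat.zero_add b).symm D)
  | tensor_empty {a b : ℕ} (D : Diagram a b) : Derivable (D ⊠ empty) D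
  | interchange {a b c a' b' c' : ℕ} (D : Diagram a b) (E : Diagram b c)
      (D' : Diagram a' b') (E' : Diagram b' c') :
      Derivable ((D ⊠ D') ⨾ (E ⊠ E')) ((D ⨾ E) ⊠ (D' ⨾ E'))
  -- symmetry
  | swap_swap : Derivable (swap ⨾ swap) (wires 2)
  | slide_natural {a b : ℕ} (D : Diagram a b) :
      Derivable ((D ⊠ wire) ⨾ slide b) (slide a ⨾ (wire ⊠ D))
  -- compact structure
  | snake_left : Derivable (@tensor 0 2 1 1 cap wire ⨾ @tensor 1 1 2 0 wire cup) wire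
  | snake_right : Derivable (@tensor 1 1 0 2 wire cap ⨾ @tensor 2 0 1 1 cup wire) wire
  | swap_cup : Derivable (swap ⨾ cup) cup
  | cap_swap : Derivable (cap ⨾ swap) cap
  -- the order of the legs of a spider is irrelevant
  | spider_swap_in (c : Colour) (i j m : ℕ) (α : Real.Angle) :
      Derivable ((wires i ⊠ swap ⊠ wires j) ⨾ spider c (i + 2 + j) m α) (spider c (i + 2 + j) m α)
  | spider_swap_out (c : Colour) (n i j : ℕ) (α : Real.Angle) :
      Derivable (spider c n (i + 2 + j) α ⨾ (wires i ⊠ swap ⊠ wires j)) (spider c n (i + 2 + j) α)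
  -- non-zero scalars are ignored
  | scalar (s : Diagram 0 0) (hs : interp s ≠ 0) : Derivable s empty
  -- spider fusion, along `k + 1` wires
  | fusion (c : Colour) (a b k d e : ℕ) (α β : Real.Angle) :
      Derivable
        (cast rfl (Nat.add_assoc b (k + 1) d) (spider c a (b + (k + 1)) α ⊠ wires d) ⨾
          (wires b ⊠ spider c ((k + 1) + d) e β))
        (spider c (a + d) (b + e) (α + β))
  -- phaseless spiders with two legs
  | spider_wire (c : Colour) : Derivable (spider c 1 1 0) wire
  | spider_cap (c : Colour) : Derivable (spider c 0 2 0) cap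
  | spider_cup (c : Colour) : Derivable (spider c 2 0 0) cup
  -- copying of classical states
  | copy (c : Colour) (κ : Real.Angle) (hκ : κ = 0 ∨ κ = (Real.pi : Real.Angle)) :
      Derivable (spider c.swap 0 1 κ ⨾ spider c 1 2 0)
        (spider c.swap 0 1 κ ⊠ spider c.swap 0 1 κ)
  -- bialgebra
  | bialgebra (c : Colour) :
      Derivable (spider c.swap 2 1 0 ⨾ spider c 1 2 0)
        ((spider c 1 2 0 ⊠ spider c 1 2 0) ⨾ middleSwap ⨾
          (spider c.swap 2 1 0 ⊠ spider c.swap 2 1 0))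
  -- a phase `π` moves through a spider of the other colour and changes the sign of its phase
  | pi_commute (c : Colour) (m : ℕ) (α : Real.Angle) :
      Derivable (spider c.swap 1 1 (Real.pi : Real.Angle) ⨾ spider c 1 m α)
        (spider c 1 m (-α) ⨾ power (spider c.swap 1 1 (Real.pi : Real.Angle)) m)
  -- the triangle on the two classical states, its inverse and its transpose
  | triangle_zero : Derivable (X 0 1 0 ⨾ triangle) (X 0 1 0)
  | triangle_one : Derivable (X 0 1 (Real.pi : Real.Angle) ⨾ triangle) (Z 0 1 0)
  | triangle_inv : Derivable (triangleInv ⨾ triangle) wire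
  | triangle_transpose :
      Derivable triangleT
        (X 1 1 (Real.pi : Real.Angle) ⨾ triangle ⨾ X 1 1 (Real.pi : Real.Angle))
  -- AND distributes over XOR
  | and_xor :
      Derivable ((X 2 1 0 ⊠ wire) ⨾ and 2)
        ((wire ⊠ wire ⊠ Z 1 2 0) ⨾ middleSwap ⨾ (and 2 ⊠ and 2) ⨾ X 2 1 0)
  -- AND is idempotent
  | and_idem : Derivable (Z 1 2 0 ⨾ and 2) wire
  -- AND is a homomorphism for COPY
  | and_copy :
      Derivable (and 2 ⨾ Z 1 2 0)
        ((Z 1 2 0 ⊠ Z 1 2 0) ⨾ middleSwap ⨾ (and 2 ⊠ and 2))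
  -- decomposition of the gadget on three lines into AND gates
  | gadget_and (α : ℝ) (h0 : 0 ≤ α) (h1 : α < 2 * Real.pi) :
      Derivable (phaseGadget (Finset.univ : Finset (Fin 3)) ((-α / 2 : ℝ) : Real.Angle))
        (power (Z 1 1 ((-α / 2 : ℝ) : Real.Angle)) 3 ⨾
          phaseAnd ({0, 1} : Finset (Fin 3)) (α : Real.Angle) ⨾
          phaseAnd ({0, 2} : Finset (Fin 3)) (α : Real.Angle) ⨾
          phaseAnd ({1, 2} : Finset (Fin 3)) (α : Real.Angle) ⨾
          phaseAnd (Finset.univ : Finset (Fin 3)) ((-2 * α : ℝ) : Real.Angle))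

/-- The phases on the right-hand side of the decomposition of the `π / 4`-phase gadget on `n` lines,
as a function of the number of lines (one, two or three) of the small gadget. -/
noncomputable def gadgetPhase (n : ℕ) : ℕ → ℝ
  | 1 => ((n : ℝ) - 2) * ((n : ℝ) - 3) * Real.pi / 8
  | 2 => (3 - (n : ℝ)) * Real.pi / 4
  | 3 => Real.pi / 4
  | _ => 0

end ZX

/-!
Semantically the gadget on `n` lines multiplies the basis state `x` by `exp (i π/4 · p(x))`, where
`p(x) = x₁ ⊕ ⋯ ⊕ xₙ` is `∑ xᵢ - 2 ∑ xᵢ xⱼ + 4 ∑ xᵢ xⱼ xₖ - 8 ⋯` over the integers.  Modulo `8` this is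
a cubic polynomial, and a cubic function is determined by its values at sums of at most three terms.
The proof carries out this argument inside the calculus.

*Strictness.*  `Arr` is the type of diagrams up to derivable equality with arbitrary numbers of
inputs and outputs, with total compositions; there the laws of a strict monoidal category are plain
equations, and `Arr.of_eq` translates back to `Derivable`.

*Functions.*  A function of the `n` lines is a diagram `n → n + 1` which appends a value to the lines
(`App`).  `Sends fs D gs` says that the diagram `D` computes the values of `gs` from those of `fs`.
By the copying and bialgebra rules, the functions generated by the lines and by XOR (`IsParity`) can
be copied and discarded, and the order in which they are computed is irrelevant.  Therefore they
form a commutative monoid `Parity n`, and the phases on them generate an abelian group,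
`PhaseGroup n`.  A phase gadget on `S` is the phase on the parity `∑ i ∈ S, line i`
(`phaseGadget_eq`).

*The phase `π / 4` is cubic.*  Let `quarter f` be the phase `π / 4` on the parity `f`.  The
decomposition rule for the gadget on three lines, used only for `α = π / 2` and pulled back along
three parities, expresses the phase `π` on the conjunction of `f`, `g`, `h` through phases on
conjunctions of two parities (`phase_add_add`); the case `f = 0` expresses the latter through phases
on parities (`phase_add`).  So the phase `π` on a conjunction of three parities is, up to sign, the
third difference `pol (pol quarter h) g f`.  It is additive in `f`, because AND distributes over XOR
and the phase `π` is multiplicative for XOR (`phaseThree_add`).  Hence `quarter` is cubic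
(`pol_pol_quarter_add`), and `map_sum_of_cubic` gives the decomposition.
-/

namespace ZX

open Diagram

/-! ### Diagrams up to derivable equality -/

/-- Derivable equality of diagrams `a → b` as a setoid. -/
def derivableSetoid (a b : ℕ) : Setoid (Diagram a b) where
  r := Derivable
  iseqv := ⟨Derivable.refl, Derivable.symm, Derivable.trans⟩

/-- Diagrams `a → b` up to derivable equality. -/
def Mor (a b : ℕ) : Type := Quotient (derivableSetoid a b)

namespace Mor

/-- Sequential composition. -/
def comp {a b c : ℕ} : Mor a b → Mor b c → Mor a c :=
  Quotient.map₂ Diagram.comp fun _ _ h _ _ h' => Derivable.comp_congr h h'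

/-- Parallel composition. -/
def tensor {a b c d : ℕ} : Mor a b → Mor c d → Mor (a + c) (b + d) :=
  Quotient.map₂ Diagram.tensor fun _ _ h _ _ h' => Derivable.tensor_congr h h'

end Mor

/-- Diagrams up to derivable equality, with arbitrary numbers of inputs and outputs.  The value
`none` of `hom` stands for an ill-typed composite; thanks to it, both compositions are total and
strictly associative, and no transport along equalities of natural numbers is needed. -/
@[ext]
structure Arr : Type where
  dom : ℕ
  cod : ℕ
  hom : Option (Mor dom cod)

namespace Arr

/-- The class of a diagram. -/
def of {a b : ℕ} (D : Diagram a b) : Arr := ⟨a, b, some (Quotient.mk (derivableSetoid a b) D)⟩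

@[simp] theorem of_dom {a b : ℕ} (D : Diagram a b) : (of D).dom = a := by rfl
@[simp] theorem of_cod {a b : ℕ} (D : Diagram a b) : (of D).cod = b := by rfl

/-- The ill-typed composites. -/
def bad (a b : ℕ) : Arr := ⟨a, b, none⟩

@[simp] theorem bad_dom (a b : ℕ) : (bad a b).dom = a := by rfl
@[simp] theorem bad_cod (a b : ℕ) : (bad a b).cod = b := by rfl

/-- Sequential composition, in the order of `⨾`. -/
def comp (f g : Arr) : Arr :=
  ⟨f.dom, g.cod,
    if h : f.cod = g.dom then
      f.hom.bind fun x => g.hom.map fun y => Mor.comp x (h ▸ y : Mor f.cod g.cod)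
    else none⟩

/-- Parallel composition. -/
def tensor (f g : Arr) : Arr :=
  ⟨f.dom + g.dom, f.cod + g.cod, f.hom.bind fun x => g.hom.map fun y => Mor.tensor x y⟩

/-- Parallel wires. -/
def one (n : ℕ) : Arr := of (wires n)

end Arr

local infixl:75 " ⊗ " => Arr.tensor
local notation "𝟙" => Arr.one

namespace Arr

@[simp] theorem tensor_dom (f g : Arr) : (f ⊗ g).dom = f.dom + g.dom := by rfl
@[simp] theorem tensor_cod (f g : Arr) : (f ⊗ g).cod = f.cod + g.cod := by rfl
@[simp] theorem one_dom (n : ℕ) : (𝟙 n).dom = n := by rfl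
@[simp] theorem one_cod (n : ℕ) : (𝟙 n).cod = n := by rfl

theorem of_eq {a b : ℕ} {D E : Diagram a b} : of D = of E ↔ Derivable D E := by
  constructor
  · intro h
    have h1 : (⟨a, b, some (Quotient.mk (derivableSetoid a b) D)⟩ : Arr) =
      ⟨a, b, some (Quotient.mk (derivableSetoid a b) E)⟩ := h
    injection h1 with _ _ h2
    exact Quotient.exact (Option.some.inj h2)
  · intro h
    have : Quotient.mk (derivableSetoid a b) D = Quotient.mk (derivableSetoid a b) E :=
      Quotient.sound h
    unfold of
    rw [this]

theorem of_cast {a b a' b' : ℕ} (ha : a = a') (hb : b = b') (D : Diagram a b) :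
    of (Diagram.cast ha hb D) = of D := by
  subst ha hb; rfl

theorem of_tensor {a b c d : ℕ} (D : Diagram a b) (E : Diagram c d) :
    of (D ⊠ E) = of D ⊗ of E := rfl

theorem cases_of {P : Arr → Prop} (h0 : ∀ a b, P (bad a b))
    (h1 : ∀ a b (D : Diagram a b), P (of D)) (f : Arr) : P f := by
  obtain ⟨a, b, _ | x⟩ := f
  · exact h0 a b
  · induction x using Quotient.inductionOn with
    | h D => exact h1 a b D

@[simp] theorem bad_tensor (a b : ℕ) (f : Arr) :
    bad a b ⊗ f = bad (a + f.dom) (b + f.cod) := rfl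

@[simp] theorem tensor_bad (a b : ℕ) (f : Arr) :
    f ⊗ bad a b = bad (f.dom + a) (f.cod + b) := by
  simp [tensor, bad]

theorem of_comp_of {a b c : ℕ} (D : Diagram a b) (E : Diagram b c) :
    (of D).comp (of E) = of (D ⨾ E) := by
  simp [comp, of, Mor.comp]
  rfl

theorem comp_of_ne {f g : Arr} (h : f.cod ≠ g.dom) : f.comp g = bad f.dom g.cod := by
  simp [comp, h, bad]

theorem bad_comp (a b : ℕ) (f : Arr) : (bad a b).comp f = bad a f.cod := by
  simp only [comp, bad, Option.bind_none]
  congr 1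
  by_cases h : b = f.dom
  · exact dif_pos h
  · exact dif_neg h

theorem comp_bad (a b : ℕ) (f : Arr) : f.comp (bad a b) = bad f.dom b := by
  simp [comp, bad]

theorem comp_assoc (f g h : Arr) : (f.comp g).comp h = f.comp (g.comp h) := by
  induction f using cases_of with
  | h0 => simp only [bad_comp]; rfl
  | h1 a b D =>
    induction g using cases_of with
    | h0 => simp only [bad_comp, comp_bad]
    | h1 b' c E =>
      induction h using cases_of with
      | h0 => simp only [comp_bad]; rfl
      | h1 c' d F =>
        by_cases hb : b = b'
        · subst hb
          by_cases hc : c = c'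
          · subst hc
            simp only [of_comp_of]
            exact of_eq.2 (Derivable.comp_assoc D E F)
          · rw [comp_of_ne (f := (of D).comp (of E)) (g := of F) hc,
              comp_of_ne (f := of E) (g := of F) hc, comp_bad]
            rfl
        · rw [comp_of_ne (f := of D) (g := (of E).comp (of F)) hb,
            comp_of_ne (f := of D) (g := of E) hb, bad_comp]
          rfl

instance : Semigroup Arr where
  mul := comp
  mul_assoc := comp_assoc

@[simp] theorem mul_dom (f g : Arr) : (f * g).dom = f.dom := by rfl
@[simp] theorem mul_cod (f g : Arr) : (f * g).cod = g.cod := by rfl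

@[simp] theorem bad_mul (a b : ℕ) (f : Arr) : bad a b * f = bad a f.cod := bad_comp a b f

@[simp] theorem mul_bad (a b : ℕ) (f : Arr) : f * bad a b = bad f.dom b := comp_bad a b f

theorem mul_of_ne {f g : Arr} (h : f.cod ≠ g.dom) : f * g = bad f.dom g.cod := comp_of_ne h

theorem of_comp {a b c : ℕ} (D : Diagram a b) (E : Diagram b c) :
    of (D ⨾ E) = of D * of E := (of_comp_of D E).symm

theorem tensor_assoc (f g h : Arr) : f ⊗ g ⊗ h = f ⊗ (g ⊗ h) := by
  induction f using cases_of with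
  | h0 => simp [add_assoc]
  | h1 a b D =>
    induction g using cases_of with
    | h0 => simp [add_assoc]
    | h1 b' c E =>
      induction h using cases_of with
      | h0 => simp [add_assoc]
      | h1 c' d F =>
        simp only [← of_tensor]
        rw [of_eq.2 (Derivable.tensor_assoc D E F), of_cast]

/-- The interchange law.  If `f'` and `g'` do not compose, both sides are ill-typed. -/
theorem interchange (f g f' g' : Arr) (h : f.cod = g.dom) :
    (f ⊗ f') * (g ⊗ g') = (f * g) ⊗ (f' * g') := by
  induction f using cases_of with
  | h0 => simp
  | h1 a b D =>
    induction g using cases_of with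
    | h0 => simp
    | h1 b' c E =>
      obtain rfl : b = b' := h
      induction f' using cases_of with
      | h0 => simp
      | h1 a' d D' =>
        induction g' using cases_of with
        | h0 => simp
        | h1 d' c' E' =>
          by_cases hd : d = d'
          · subst hd
            simp only [← of_comp, ← of_tensor]
            exact of_eq.2 (Derivable.interchange D E D' E')
          · rw [mul_of_ne (f := of D') (by simpa using hd), mul_of_ne (by simpa using hd)]
            simp

@[simp] theorem one_mul' (n : ℕ) (f : Arr) (h : f.dom = n) : 𝟙 n * f = f := by
  induction f using cases_of with
  | h0 => subst h; simp
  | h1 a b D =>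
    obtain rfl : a = n := h
    rw [one, ← of_comp]
    exact of_eq.2 (Derivable.wires_comp D)

@[simp] theorem mul_one' (n : ℕ) (f : Arr) (h : f.cod = n) : f * 𝟙 n = f := by
  induction f using cases_of with
  | h0 => subst h; simp
  | h1 a b D =>
    obtain rfl : b = n := h
    rw [one, ← of_comp]
    exact of_eq.2 (Derivable.comp_wires D)

@[simp] theorem zero_tensor (f : Arr) : 𝟙 0 ⊗ f = f := by
  induction f using cases_of with
  | h0 => simp [one]
  | h1 a b D =>
    rw [show 𝟙 0 = of empty from rfl, ← of_tensor, of_eq.2 (Derivable.empty_tensor D), of_cast]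

@[simp] theorem tensor_zero (f : Arr) : f ⊗ 𝟙 0 = f := by
  induction f using cases_of with
  | h0 => simp [one]
  | h1 a b D =>
    rw [show 𝟙 0 = of empty from rfl, ← of_tensor]
    exact of_eq.2 (Derivable.tensor_empty D)

theorem one_succ (n : ℕ) : 𝟙 (n + 1) = 𝟙 n ⊗ of wire := rfl

theorem of_wire : of wire = 𝟙 1 := by
  have := one_succ 0
  simpa using this.symm

theorem one_tensor_one (m n : ℕ) : 𝟙 m ⊗ 𝟙 n = 𝟙 (m + n) := by
  induction n with
  | zero => simp
  | succ n ih => rw [one_succ, ← tensor_assoc, ih, ← add_assoc, one_succ]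

/-- No typing hypothesis is needed, as both sides are ill-typed if `f * g` is. -/
theorem mul_tensor_one (f g : Arr) (n : ℕ) : (f * g) ⊗ 𝟙 n = (f ⊗ 𝟙 n) * (g ⊗ 𝟙 n) := by
  by_cases h : f.cod = g.dom
  · rw [interchange _ _ _ _ h, mul_one' n _ rfl]
  · rw [mul_of_ne h, mul_of_ne (by simpa using h)]
    simp

theorem one_tensor_mul (f g : Arr) (n : ℕ) : 𝟙 n ⊗ (f * g) = (𝟙 n ⊗ f) * (𝟙 n ⊗ g) := by
  rw [interchange _ _ _ _ rfl, mul_one' n _ rfl]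

/-- The factorisation of a parallel composite in which the left factor comes first. -/
theorem tensor_eq_left (f g : Arr) {m n : ℕ} (hm : f.cod = m) (hn : g.dom = n) :
    (f ⊗ 𝟙 n) * (𝟙 m ⊗ g) = f ⊗ g := by
  rw [interchange _ _ _ _ hm, mul_one' m _ hm, one_mul' n _ hn]

/-- The factorisation of a parallel composite in which the right factor comes first. -/
theorem tensor_eq_right (f g : Arr) {m n : ℕ} (hm : f.dom = m) (hn : g.cod = n) :
    (𝟙 m ⊗ g) * (f ⊗ 𝟙 n) = f ⊗ g := by
  rw [interchange _ _ _ _ hm.symm, mul_one' n _ hn, one_mul' m _ hm]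

/-- The class of a spider. -/
def sp (c : Colour) (n m : ℕ) (α : Real.Angle) : Arr := of (spider c n m α)

@[simp] theorem sp_dom (c : Colour) (n m : ℕ) (α : Real.Angle) : (sp c n m α).dom = n := by rfl
@[simp] theorem sp_cod (c : Colour) (n m : ℕ) (α : Real.Angle) : (sp c n m α).cod = m := by rfl

/-- The class of the diagram that moves the last of `n + 1` wires to the first place. -/
def sl (n : ℕ) : Arr := of (slide n)

@[simp] theorem sl_dom (n : ℕ) : (sl n).dom = n + 1 := by rfl
@[simp] theorem sl_cod (n : ℕ) : (sl n).cod = 1 + n := by rfl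

end Arr

local notation "ζ" => Arr.sp Colour.green
local notation "χ" => Arr.sp Colour.red

namespace Arr

/-! ### The symmetry -/

theorem slide_succ (n : ℕ) :
    sl (n + 1) = (𝟙 n ⊗ of swap) * (sl n ⊗ 𝟙 1) := by
  rw [← of_wire]
  exact of_comp (@Diagram.tensor n n 2 2 (wires n) swap)
    (@Diagram.tensor (n + 1) (1 + n) 1 1 (slide n) wire)

@[simp] theorem slide_zero : sl 0 = 𝟙 1 := of_wire

@[simp] theorem slide_one : sl 1 = of swap := by
  simpa [one_tensor_one] using slide_succ 0

theorem slide_natural (f : Arr) {a b : ℕ} (ha : f.dom = a) (hb : f.cod = b) :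
    (f ⊗ 𝟙 1) * sl b = sl a * (𝟙 1 ⊗ f) := by
  subst ha hb
  induction f using cases_of with
  | h0 => simp
  | h1 a b D =>
    rw [← of_wire]
    exact (of_comp _ _).symm.trans ((of_eq.2 (Derivable.slide_natural D)).trans (of_comp _ _))

/-- The first of `n + 1` wires is moved across the others to the last place. -/
def slideInv : ℕ → Arr
  | 0 => 𝟙 1
  | n + 1 => (slideInv n ⊗ 𝟙 1) * (𝟙 n ⊗ of swap)

@[simp] theorem slideInv_dom (n : ℕ) : (slideInv n).dom = 1 + n := by
  induction n with
  | zero => rfl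
  | succ n ih => simp [slideInv, ih, add_assoc]

@[simp] theorem slideInv_cod (n : ℕ) : (slideInv n).cod = n + 1 := by
  cases n <;> rfl

theorem swap_mul_swap : of swap * of swap = 𝟙 2 := by
  rw [← of_comp]
  exact of_eq.2 Derivable.swap_swap

@[simp] theorem slideInv_one : slideInv 1 = of swap := by
  simp [slideInv, one_tensor_one]

theorem slide_mul_slideInv (n : ℕ) : sl n * slideInv n = 𝟙 (n + 1) := by
  induction n with
  | zero => simp [slideInv]
  | succ n ih =>
    rw [slide_succ, slideInv, mul_assoc, ← mul_assoc (sl n ⊗ _), ← mul_tensor_one, ih,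
      one_tensor_one, one_mul' _ _ (by simp), ← one_tensor_mul, swap_mul_swap, one_tensor_one]

theorem slideInv_mul_slide (n : ℕ) : slideInv n * sl n = 𝟙 (1 + n) := by
  induction n with
  | zero => simp [slideInv]
  | succ n ih =>
    rw [slide_succ, slideInv, mul_assoc, ← mul_assoc (𝟙 n ⊗ of swap), ← one_tensor_mul,
      swap_mul_swap, one_tensor_one, one_mul' _ _ (by simp), ← mul_tensor_one, ih,
      one_tensor_one, add_assoc]

/-- The slides are natural in the `n` wires that are crossed, and so are their inverses. -/
theorem slideInv_natural (f : Arr) {a b : ℕ} (ha : f.dom = a) (hb : f.cod = b) :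
    (𝟙 1 ⊗ f) * slideInv b = slideInv a * (f ⊗ 𝟙 1) := by
  rw [← one_mul' (1 + a) (𝟙 1 ⊗ f) (by simp [ha]), ← slideInv_mul_slide, mul_assoc, mul_assoc,
    ← mul_assoc _ _ (slideInv b), ← slide_natural f ha hb, mul_assoc, slide_mul_slideInv,
    mul_one' _ _ (by simp [hb])]

/-! ### Spiders -/

/-- Fusion of two spiders along the last `k + 1` outputs of the first and the first `k + 1` inputs
of the second one. -/
theorem fusion (c : Colour) (a b k d e : ℕ) (α β : Real.Angle) :
    (sp c a (b + (k + 1)) α ⊗ 𝟙 d) * (𝟙 b ⊗ sp c ((k + 1) + d) e β) =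
      sp c (a + d) (b + e) (α + β) := by
  refine Eq.trans ?_ (of_eq.2 (Derivable.fusion c a b k d e α β))
  rw [of_comp, of_cast]
  rfl

theorem swap_mul_spider (c : Colour) (i j m : ℕ) (α : Real.Angle) :
    (𝟙 i ⊗ of swap ⊗ 𝟙 j) * sp c (i + 2 + j) m α = sp c (i + 2 + j) m α := by
  refine Eq.trans ?_ (of_eq.2 (Derivable.spider_swap_in c i j m α))
  rw [of_comp]
  rfl

theorem spider_mul_swap (c : Colour) (n i j : ℕ) (α : Real.Angle) :
    sp c n (i + 2 + j) α * (𝟙 i ⊗ of swap ⊗ 𝟙 j) = sp c n (i + 2 + j) α := by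
  refine Eq.trans ?_ (of_eq.2 (Derivable.spider_swap_out c n i j α))
  rw [of_comp]
  rfl

@[simp] theorem spider_one_one (c : Colour) : sp c 1 1 0 = 𝟙 1 :=
  (of_eq.2 (Derivable.spider_wire c)).trans of_wire

theorem spider_cap (c : Colour) : sp c 0 2 0 = of cap :=
  of_eq.2 (Derivable.spider_cap c)

theorem spider_cup (c : Colour) : sp c 2 0 0 = of cup :=
  of_eq.2 (Derivable.spider_cup c)

/-- Fusion of a spider into the second of two inputs. -/
theorem fusion_snd_in (c : Colour) (m : ℕ) (α : Real.Angle) :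
    (𝟙 1 ⊗ sp c 2 1 0) * sp c 2 m α = sp c 3 m α := by
  have h1 : sp c 2 m α = slideInv 1 * sp c 2 m α := by
    simpa using (swap_mul_spider c 0 0 m α).symm
  rw [h1, ← mul_assoc, slideInv_natural (a := 2) (b := 1) _ rfl rfl, mul_assoc]
  have h2 := fusion c 2 0 0 1 m 0 α
  simp only [zero_tensor, zero_add] at h2
  rw [h2, slideInv, slideInv_one, mul_assoc]
  have h3 := swap_mul_spider c 1 0 m α
  have h4 := swap_mul_spider c 0 1 m α
  simp only [zero_tensor, tensor_zero, zero_add] at h3 h4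
  rw [h3, h4]

/-- Fusion of a spider into the first of two outputs. -/
theorem fusion_fst_out (c : Colour) (n : ℕ) (α : Real.Angle) :
    sp c n 2 α * (sp c 1 2 0 ⊗ 𝟙 1) = sp c n 3 α := by
  have h1 : sp c n 2 α = sp c n 2 α * slideInv 1 := by
    simpa using (spider_mul_swap c n 0 0 α).symm
  rw [h1, mul_assoc, ← slideInv_natural (a := 1) (b := 2) _ rfl rfl, ← mul_assoc]
  have h2 := fusion c n 1 0 0 2 α 0
  simp only [tensor_zero, add_zero, zero_add] at h2
  rw [h2, slideInv, slideInv_one, ← mul_assoc]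
  have h3 := spider_mul_swap c n 1 0 α
  have h4 := spider_mul_swap c n 0 1 α
  simp only [zero_tensor, tensor_zero, zero_add] at h3 h4
  rw [h4, h3]

theorem fusion_one_one (c : Colour) (n m : ℕ) (α β : Real.Angle) :
    sp c n 1 α * sp c 1 m β = sp c n m (α + β) := by
  simpa using fusion c n 0 0 0 m α β

theorem fusion_fst_in (c : Colour) (n m : ℕ) (α β : Real.Angle) :
    (sp c n 1 α ⊗ 𝟙 1) * sp c 2 m β = sp c (n + 1) m (α + β) := by
  simpa using fusion c n 0 0 1 m α β

theorem fusion_snd_out (c : Colour) (n m : ℕ) (α β : Real.Angle) :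
    sp c n 2 α * (𝟙 1 ⊗ sp c 1 m β) = sp c n (1 + m) (α + β) := by
  simpa using fusion c n 1 0 0 m α β

/-- Bending the last output of a spider. -/
theorem spider_bend (c : Colour) (n m : ℕ) (α : Real.Angle) :
    (sp c n (m + 1) α ⊗ 𝟙 1) * (𝟙 m ⊗ of cup) = sp c (n + 1) m α := by
  rw [← spider_cup c]
  simpa using fusion c n m 0 1 0 α 0

/-- Bending the only output of a spider. -/
theorem spider_bend_one (c : Colour) (n : ℕ) (α : Real.Angle) :
    (sp c n 1 α ⊗ 𝟙 1) * of cup = sp c (n + 1) 0 α := by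
  simpa using spider_bend c n 0 α

theorem snake_left : (of cap ⊗ 𝟙 1) * (𝟙 1 ⊗ of cup) = 𝟙 1 := by
  rw [← of_wire]
  exact (of_comp _ _).symm.trans (of_eq.2 Derivable.snake_left)

/-- Bending the input of an effect does not lose information. -/
theorem cap_cancel {f g : Arr} (hf : f.dom = 1) (hf' : f.cod = 0) (hg : g.dom = 1)
    (hg' : g.cod = 0) (h : of cap * (f ⊗ 𝟙 1) = of cap * (g ⊗ 𝟙 1)) : f = g := by
  have key : ∀ f : Arr, f.dom = 1 → f.cod = 0 →
      ((of cap * (f ⊗ 𝟙 1)) ⊗ 𝟙 1) * of cup = f := by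
    intro f hf hf'
    have h1 : (f ⊗ 𝟙 2) * of cup = (𝟙 1 ⊗ of cup) * f := by
      have h2 := tensor_eq_left f (of cup) (m := 0) (n := 2) hf' rfl
      have h3 := tensor_eq_right f (of cup) (m := 1) (n := 0) hf rfl
      rw [zero_tensor] at h2
      rw [tensor_zero] at h3
      rw [h2, h3]
    rw [mul_tensor_one, tensor_assoc f, one_tensor_one, mul_assoc, h1, ← mul_assoc, snake_left,
      one_mul' _ _ hf]
  rw [← key f hf hf', h, key g hg hg']

theorem copy_state (c : Colour) {κ : Real.Angle} (hκ : κ = 0 ∨ κ = (Real.pi : Real.Angle)) :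
    sp c.swap 0 1 κ * sp c 1 2 0 = sp c.swap 0 1 κ ⊗ sp c.swap 0 1 κ :=
  (of_comp _ _).symm.trans (of_eq.2 (Derivable.copy c κ hκ))

/-- The transpose of `copy_state`. -/
theorem copy_effect (c : Colour) {κ : Real.Angle} (hκ : κ = 0 ∨ κ = (Real.pi : Real.Angle)) :
    sp c 2 1 0 * sp c.swap 1 0 κ = sp c.swap 1 0 κ ⊗ sp c.swap 1 0 κ := by
  set s := sp c.swap 0 1 κ with hs
  have hb : (s ⊗ 𝟙 1) * of cup = sp c.swap 1 0 κ := spider_bend_one c.swap 0 κ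
  have h1 : (sp c 1 2 0 ⊗ 𝟙 2) * (𝟙 1 ⊗ of cup ⊗ 𝟙 1) * of cup = sp c 3 0 0 := by
    have h2 := spider_bend c 1 1 0
    have h3 := spider_bend_one c 2 0
    rw [← h3, ← h2, mul_tensor_one, tensor_assoc (sp c 1 _ 0), one_tensor_one]
  have h4 := fusion_snd_in c 0 0
  have h5 : s ⊗ sp c 2 1 0 = (s ⊗ 𝟙 2) * (𝟙 1 ⊗ sp c 2 1 0) :=
    (tensor_eq_left s _ rfl rfl).symm
  have h6 : sp c 2 1 0 * (s ⊗ 𝟙 1) = s ⊗ sp c 2 1 0 := by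
    simpa using tensor_eq_right s (sp c 2 1 0) (m := 0) (n := 1) rfl rfl
  calc sp c 2 1 0 * sp c.swap 1 0 κ
      = (s ⊗ 𝟙 2) * sp c 3 0 0 := by
        rw [← hb, ← mul_assoc, h6, h5, mul_assoc, ← spider_cup c, h4]
    _ = (s ⊗ s ⊗ 𝟙 2) * (𝟙 1 ⊗ of cup ⊗ 𝟙 1) * of cup := by
        rw [← h1, ← mul_assoc, ← mul_assoc, ← mul_tensor_one, copy_state c hκ]
    _ = (s ⊗ sp c.swap 1 0 κ ⊗ 𝟙 1) * of cup := by
        congr 1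
        rw [← one_tensor_one 1 1, ← tensor_assoc, ← mul_tensor_one, tensor_assoc,
          interchange _ _ _ _ rfl, hb, mul_one' 1 s rfl]
    _ = sp c.swap 1 0 κ ⊗ sp c.swap 1 0 κ := by
        have h7 := tensor_eq_right s (sp c.swap 1 0 κ ⊗ 𝟙 1) (m := 0) (n := 1) rfl (by simp)
        have h8 := tensor_eq_left (sp c.swap 1 0 κ) (sp c.swap 1 0 κ) (m := 0) (n := 1) rfl rfl
        rw [zero_tensor] at h7 h8
        rw [tensor_assoc, ← h7, mul_assoc, hb, h8]

/-! ### The triangle -/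

theorem triangleInv_eq : of triangleInv =
    ζ 1 1 (Real.pi : Real.Angle) * of triangle * ζ 1 1 (Real.pi : Real.Angle) := by
  rw [triangleInv, of_comp, of_comp]
  rfl

theorem triangleInv_mul_triangle : of triangleInv * of triangle = 𝟙 1 := by
  rw [← of_comp, ← of_wire]
  exact of_eq.2 Derivable.triangle_inv

theorem pi_mul_pi (c : Colour) :
    sp c 1 1 (Real.pi : Real.Angle) * sp c 1 1 (Real.pi : Real.Angle) = 𝟙 1 := by
  rw [fusion_one_one, Real.Angle.coe_pi_add_coe_pi, spider_one_one]

/-- Only the other composite is an axiom; this one follows because the phase `π` is an involution. -/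
theorem triangle_mul_triangleInv : of triangle * of triangleInv = 𝟙 1 := by
  set p := ζ 1 1 (Real.pi : Real.Angle) with hp
  have h : of triangle * p * of triangle = p := by
    have h1 := congrArg (p * ·) triangleInv_mul_triangle
    simp only [triangleInv_eq, ← mul_assoc] at h1
    rwa [pi_mul_pi, one_mul' _ _ (by simp), mul_one' 1 p rfl] at h1
  rw [triangleInv_eq, ← mul_assoc, ← mul_assoc, h, pi_mul_pi]

theorem state_triangle : χ 0 1 0 * of triangle = χ 0 1 0 :=
  (of_comp _ _).symm.trans (of_eq.2 Derivable.triangle_zero)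

theorem state_triangleInv : χ 0 1 0 * of triangleInv = χ 0 1 0 := by
  conv_lhs => rw [← state_triangle, mul_assoc, triangle_mul_triangleInv]
  simp

theorem cap_mul_slideInv : of cap * slideInv 1 = of cap := by
  rw [slideInv_one]
  exact (of_comp _ _).symm.trans (of_eq.2 Derivable.cap_swap)

/-- A map moves from one end of a cap to the other. -/
theorem cap_mul_tensor_one (f : Arr) {b : ℕ} (ha : f.dom = 1) (hb : f.cod = b) :
    of cap * (f ⊗ 𝟙 1) = of cap * (𝟙 1 ⊗ f) * slideInv b := by
  rw [mul_assoc, slideInv_natural f ha hb, ← mul_assoc, cap_mul_slideInv]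

theorem cap_mul_effect : of cap * (ζ 1 0 0 ⊗ 𝟙 1) = ζ 0 1 0 := by
  rw [cap_mul_tensor_one (b := 0) _ rfl rfl, ← spider_cap Colour.green, fusion_snd_out]
  simp [slideInv]

/-- The phase `π` is moved around a cap, where the rule for effects applies. -/
theorem green_state_mul_pi : ζ 0 1 0 * χ 1 1 (Real.pi : Real.Angle) = ζ 0 1 0 := by
  have h1 : χ 1 1 (Real.pi : Real.Angle) * ζ 1 0 0 = ζ 1 0 0 := by
    have h := of_eq.2 (Derivable.pi_commute Colour.green 0 0)
    rw [neg_zero, power, of_comp, of_comp] at h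
    refine Eq.trans h (mul_one' 0 _ rfl)
  have h2 : of cap * (χ 1 1 (Real.pi : Real.Angle) ⊗ 𝟙 1) =
      of cap * (𝟙 1 ⊗ χ 1 1 (Real.pi : Real.Angle)) := by
    rw [cap_mul_tensor_one (b := 1) _ rfl rfl, ← spider_cap Colour.red, fusion_snd_out,
      slideInv_one]
    simpa using spider_mul_swap Colour.red 0 0 0 (Real.pi : Real.Angle)
  have h3 := tensor_eq_left (ζ 1 0 0) (χ 1 1 (Real.pi : Real.Angle)) (m := 0) (n := 1) rfl rfl
  have h4 := tensor_eq_right (ζ 1 0 0) (χ 1 1 (Real.pi : Real.Angle)) (m := 1) (n := 1) rfl rfl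
  rw [zero_tensor] at h3
  rw [← cap_mul_effect, mul_assoc, h3, ← h4, ← mul_assoc, ← h2, mul_assoc, ← mul_tensor_one, h1]

/-- The transpose of the action of the triangle on classical states: `⟨0| T = ⟨0| + ⟨1|`. -/
theorem triangle_mul_effect : of triangle * χ 1 0 0 = ζ 1 0 0 := by
  have hT : of triangleT = (𝟙 1 ⊗ of cap) * (𝟙 1 ⊗ (of triangle ⊗ 𝟙 1)) * (of cup ⊗ 𝟙 1) := by
    rw [← tensor_assoc, ← of_wire]
    refine (of_comp _ _).trans ?_
    congr 1
  have hT' : of triangleT =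
      χ 1 1 (Real.pi : Real.Angle) * of triangle * χ 1 1 (Real.pi : Real.Angle) := by
    rw [of_eq.2 Derivable.triangle_transpose, of_comp, of_comp]
    rfl
  have h1 : χ 0 1 0 * of triangleT = ζ 0 1 0 := by
    rw [hT', ← mul_assoc, ← mul_assoc, fusion_one_one, zero_add]
    have h : χ 0 1 (Real.pi : Real.Angle) * of triangle = ζ 0 1 0 :=
      (of_comp _ _).symm.trans (of_eq.2 Derivable.triangle_one)
    rw [h, green_state_mul_pi]
  have h2 : χ 0 1 0 * of triangleT = of cap * ((of triangle * χ 1 0 0) ⊗ 𝟙 1) := by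
    have e1 := tensor_eq_left (χ 0 1 0) (of cap) (m := 1) (n := 0) rfl rfl
    have e2 := tensor_eq_right (χ 0 1 0) (of cap) (m := 0) (n := 2) rfl rfl
    have e3 := tensor_eq_left (χ 0 1 0) (of triangle ⊗ 𝟙 1) (m := 1) (n := 2) rfl (by simp)
    have e4 := tensor_eq_right (χ 0 1 0) (of triangle ⊗ 𝟙 1) (m := 0) (n := 2) rfl (by simp)
    have e5 := spider_bend_one Colour.red 0 0
    rw [tensor_zero] at e1
    rw [zero_tensor] at e2 e4
    rw [hT, mul_tensor_one, ← e5, mul_tensor_one, ← mul_assoc, ← mul_assoc, e1, ← e2,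
      mul_assoc (of cap), e3, ← e4, tensor_assoc (χ 0 1 0), one_tensor_one]
    simp only [mul_assoc]
  apply cap_cancel rfl rfl rfl rfl
  rw [← h2, h1, cap_mul_effect]

/-! ### The AND gate -/

theorem and_two : of (and 2) = (of triangle ⊗ of triangle) * ζ 2 1 0 * of triangleInv := by
  rw [Diagram.and, of_comp, of_comp, power, of_tensor, power, of_tensor]
  change (𝟙 0 ⊗ _ ⊗ _) * _ * _ = _
  rw [zero_tensor]
  rfl

theorem and_three : of (and 3) =
    (of triangle ⊗ of triangle ⊗ of triangle) * ζ 3 1 0 * of triangleInv := by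
  rw [Diagram.and, of_comp, of_comp, power, of_tensor, power, of_tensor, power, of_tensor]
  change (𝟙 0 ⊗ _ ⊗ _ ⊗ _) * _ * _ = _
  rw [zero_tensor]
  rfl

/-- The inner inverse triangle cancels against a triangle of the outer gate. -/
theorem and_three_eq : of (and 3) = (𝟙 1 ⊗ of (and 2)) * of (and 2) := by
  set T := of triangle with hT
  have h2 : of (and 2) * T = (T ⊗ T) * ζ 2 1 0 := by
    rw [and_two, mul_assoc, triangleInv_mul_triangle, mul_one' _ _ (by simp), hT]
  have h3 : (𝟙 1 ⊗ of (and 2)) * (T ⊗ T) = T ⊗ (of (and 2) * T) := by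
    rw [interchange _ _ _ _ rfl, one_mul' 1 T rfl]
  have h4 : T ⊗ ((T ⊗ T) * ζ 2 1 0) = (T ⊗ (T ⊗ T)) * (𝟙 1 ⊗ ζ 2 1 0) := by
    rw [interchange _ _ _ _ rfl, mul_one' 1 T rfl]
  conv_rhs => rw [and_two]
  rw [← mul_assoc, ← mul_assoc, ← and_two, h3, h2, h4, mul_assoc (_ ⊗ _) _ (ζ 2 1 0),
    fusion_snd_in, and_three, tensor_assoc]

theorem and_two_discard : of (and 2) * ζ 1 0 0 = ζ 1 0 0 ⊗ ζ 1 0 0 := by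
  have h1 : of triangleInv * ζ 1 0 0 = χ 1 0 0 := by
    rw [← triangle_mul_effect, ← mul_assoc, triangleInv_mul_triangle, one_mul' _ _ (by simp)]
  have h2 : ζ 2 1 0 * χ 1 0 0 = χ 1 0 0 ⊗ χ 1 0 0 := copy_effect Colour.green (Or.inl rfl)
  rw [and_two, mul_assoc, h1, mul_assoc, h2, interchange _ _ _ _ rfl, triangle_mul_effect]

/-- The conjunction of `0` with anything is `0`. -/
theorem and_two_zero : (χ 0 1 0 ⊗ 𝟙 1) * of (and 2) = ζ 1 0 0 * χ 0 1 0 := by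
  have h1 : (χ 0 1 0 ⊗ 𝟙 1) * (of triangle ⊗ of triangle) =
      of triangle * (χ 0 1 0 ⊗ 𝟙 1) := by
    have e1 := tensor_eq_right (χ 0 1 0) (of triangle) (m := 0) (n := 1) rfl rfl
    rw [zero_tensor] at e1
    rw [interchange _ _ _ _ rfl, state_triangle, one_mul' _ _ (by simp), e1]
  have h2 : (χ 0 1 0 ⊗ 𝟙 1) * ζ 2 1 0 = χ 1 0 0 * χ 0 1 0 := by
    have e1 := spider_bend Colour.green 1 1 0
    have e2 : χ 0 1 0 * ζ 1 2 0 = χ 0 1 0 ⊗ χ 0 1 0 := copy_state Colour.green (Or.inl rfl)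
    have e3 := tensor_eq_right (χ 0 1 0) (χ 1 0 0) (m := 0) (n := 0) rfl rfl
    rw [tensor_zero, zero_tensor] at e3
    rw [← e1, ← mul_assoc, ← mul_tensor_one, e2, e3, tensor_assoc, interchange _ _ _ _ rfl,
      spider_bend_one, mul_one' _ _ (by simp)]
  rw [and_two, ← mul_assoc, ← mul_assoc, h1, mul_assoc (of triangle), h2, ← mul_assoc,
    triangle_mul_effect, mul_assoc, state_triangleInv]

theorem and_three_zero :
    (χ 0 1 0 ⊗ 𝟙 2) * of (and 3) = (ζ 1 0 0 ⊗ ζ 1 0 0) * χ 0 1 0 := by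
  have h1 := tensor_eq_left (χ 0 1 0) (of (and 2)) (m := 1) (n := 2) rfl rfl
  have h2 := tensor_eq_right (χ 0 1 0) (of (and 2)) (m := 0) (n := 1) rfl rfl
  rw [zero_tensor] at h2
  rw [and_three_eq, ← mul_assoc, h1, ← h2, mul_assoc, and_two_zero, ← mul_assoc, and_two_discard]

theorem and_two_copy : of (and 2) * ζ 1 2 0 =
    (ζ 1 2 0 ⊗ ζ 1 2 0) * (𝟙 1 ⊗ of swap ⊗ 𝟙 1) * (of (and 2) ⊗ of (and 2)) := by
  rw [← of_wire]
  refine (of_comp _ _).symm.trans ((of_eq.2 Derivable.and_copy).trans ?_)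
  rw [of_comp, of_comp]
  rfl

theorem and_two_xor : (χ 2 1 0 ⊗ 𝟙 1) * of (and 2) =
    (𝟙 2 ⊗ ζ 1 2 0) * (𝟙 1 ⊗ of swap ⊗ 𝟙 1) * (of (and 2) ⊗ of (and 2)) * χ 2 1 0 := by
  rw [← one_tensor_one 1 1, ← of_wire]
  refine (of_comp _ _).symm.trans ((of_eq.2 Derivable.and_xor).trans ?_)
  rw [of_comp, of_comp, of_comp]
  rfl

/-! ### The XOR gate and green effects -/

theorem xor_copy : χ 2 1 0 * ζ 1 2 0 =
    (ζ 1 2 0 ⊗ ζ 1 2 0) * (𝟙 1 ⊗ of swap ⊗ 𝟙 1) * (χ 2 1 0 ⊗ χ 2 1 0) := by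
  rw [← of_wire]
  refine (of_comp _ _).symm.trans ((of_eq.2 (Derivable.bialgebra Colour.green)).trans ?_)
  rw [of_comp, of_comp]
  rfl

theorem xor_effect {κ : Real.Angle} (hκ : κ = 0 ∨ κ = (Real.pi : Real.Angle)) :
    χ 2 1 0 * ζ 1 0 κ = ζ 1 0 κ ⊗ ζ 1 0 κ :=
  copy_effect Colour.red hκ

theorem copy_mul_effects (α β : Real.Angle) :
    ζ 1 2 0 * (ζ 1 0 α ⊗ ζ 1 0 β) = ζ 1 0 (α + β) := by
  have h := tensor_eq_right (ζ 1 0 α) (ζ 1 0 β) (m := 1) (n := 0) rfl rfl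
  rw [tensor_zero] at h
  rw [← h, ← mul_assoc, fusion_snd_out, fusion_one_one, zero_add, add_comm]

/-- The scalar `√2`, which is ignored. -/
theorem state_mul_effect (α : Real.Angle) : χ 0 1 0 * ζ 1 0 α = 𝟙 0 := by
  refine (of_comp _ _).symm.trans (of_eq.2 (Derivable.scalar _ ?_))
  intro h
  have h1 : (interp (Z 1 0 α) * interp (X 0 1 0)) Fin.elim0 Fin.elim0 = 0 :=
    congrFun (congrFun h Fin.elim0) Fin.elim0
  rw [Matrix.mul_apply, ← (Equiv.funUnique (Fin 1) Bool).symm.sum_comp, Fintype.sum_bool] at h1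
  simp [interp] at h1

end Arr

open Arr

/-! ### Functions on `n` lines -/

/-- A diagram on `n` lines with one further output to the right of the lines, to be thought of as
a function of the lines whose value is appended to them. -/
@[ext]
structure App (n : ℕ) : Type where
  arr : Arr
  dom_eq : arr.dom = n
  cod_eq : arr.cod = n + 1

attribute [simp] App.dom_eq App.cod_eq

variable {n : ℕ}

/-- The lines together with the values of a list of functions, in the order of the list. -/
def tuple : List (App n) → Arr
  | [] => 𝟙 n
  | f :: fs => tuple fs * (f.arr ⊗ 𝟙 fs.length)

@[simp] theorem tuple_dom (fs : List (App n)) : (tuple fs).dom = n := by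
  induction fs with
  | nil => simp [tuple]
  | cons f fs ih => simp [tuple, ih]

@[simp] theorem tuple_cod (fs : List (App n)) : (tuple fs).cod = n + fs.length := by
  cases fs with
  | nil => simp [tuple]
  | cons f fs => simp [tuple]; omega

@[simp] theorem tuple_nil : tuple ([] : List (App n)) = 𝟙 n := by
  rw [tuple]

@[simp] theorem tuple_singleton (f : App n) : tuple [f] = f.arr := by
  simp [tuple]

theorem tuple_append (fs gs : List (App n)) :
    tuple (fs ++ gs) = tuple gs * (tuple fs ⊗ 𝟙 gs.length) := by
  induction fs with
  | nil => simp [one_tensor_one]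
  | cons f fs ih =>
    rw [List.cons_append, tuple, tuple, ih, mul_tensor_one, tensor_assoc, one_tensor_one,
      List.length_append, mul_assoc]

/-- The diagram `D` turns the values of the functions `fs` into those of the functions `gs`. -/
structure Sends (fs : List (App n)) (D : Arr) (gs : List (App n)) : Prop where
  dom_eq : D.dom = fs.length
  cod_eq : D.cod = gs.length
  eq : tuple fs * (𝟙 n ⊗ D) = tuple gs

namespace Sends

variable {fs gs hs fs' gs' : List (App n)} {D E : Arr}

theorem id (fs : List (App n)) : Sends fs (𝟙 fs.length) fs :=
  ⟨by simp, by simp, by simp [one_tensor_one]⟩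

theorem comp (h : Sends fs D gs) (h' : Sends gs E hs) : Sends fs (D * E) hs :=
  ⟨h.dom_eq, h'.cod_eq, by rw [one_tensor_mul, ← mul_assoc, h.eq, h'.eq]⟩

/-- The converse of `Sends.comp`: the values of `gs` determine what `E` makes of them. -/
theorem of_comp (h : Sends fs D gs) (h' : Sends fs (D * E) hs) (hE : E.dom = gs.length) :
    Sends gs E hs :=
  ⟨hE, h'.cod_eq, by rw [← h.eq, mul_assoc, ← one_tensor_mul, h'.eq]⟩

theorem tensor (h : Sends fs D gs) (h' : Sends fs' E gs') :
    Sends (fs ++ fs') (D ⊗ E) (gs ++ gs') := by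
  refine ⟨by simp [h.dom_eq, h'.dom_eq], by simp [h.cod_eq, h'.cod_eq], ?_⟩
  have e1 : (tuple fs ⊗ 𝟙 fs'.length) * (𝟙 (n + fs.length) ⊗ E) =
      (𝟙 n ⊗ E) * (tuple fs ⊗ 𝟙 gs'.length) := by
    rw [tensor_eq_left _ _ (by simp) h'.dom_eq, tensor_eq_right _ _ (by simp) h'.cod_eq]
  have e2 : D ⊗ E = (𝟙 fs.length ⊗ E) * (D ⊗ 𝟙 gs'.length) :=
    (tensor_eq_right _ _ h.dom_eq h'.cod_eq).symm
  rw [tuple_append, tuple_append, ← h.eq, ← h'.eq, e2, one_tensor_mul, ← tensor_assoc,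
    ← tensor_assoc, one_tensor_one, mul_assoc, ← mul_assoc (_ ⊗ _) _ (𝟙 n ⊗ D ⊗ _), e1,
    mul_tensor_one]
  simp only [mul_assoc]

theorem unique {f g : App n} (h : Sends fs D [f]) (h' : Sends fs D [g]) : f = g := by
  have := h.eq.symm.trans h'.eq
  rw [tuple_singleton, tuple_singleton] at this
  exact App.ext this

end Sends

/-- The function computed from the values of `fs` by the diagram `D`. -/
def post (fs : List (App n)) (D : Arr) (h : D.cod = 1) : App n where
  arr := tuple fs * (𝟙 n ⊗ D)
  dom_eq := by simp
  cod_eq := by simp [h]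

theorem sends_post (fs : List (App n)) (D : Arr) (h : D.cod = 1) (h' : D.dom = fs.length) :
    Sends fs D [post fs D h] :=
  ⟨h', h, by rw [tuple_singleton, post]⟩

/-- The order in which the values of two functions are computed is irrelevant. -/
def Commutes (f g : App n) : Prop := Sends [f, g] (of swap) [g, f]

theorem Commutes.symm {f g : App n} (h : Commutes f g) : Commutes g f := by
  refine Sends.of_comp h ?_ rfl
  rw [swap_mul_swap]
  exact Sends.id [f, g]

/-- A function that commutes with each function of a list can be computed before all of them. -/
theorem sends_slide (fs : List (App n)) (g : App n) (h : ∀ f ∈ fs, Commutes f g) :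
    Sends (fs ++ [g]) (sl fs.length) (g :: fs) := by
  induction fs using List.reverseRecOn with
  | nil => rw [List.length_nil, slide_zero]; exact Sends.id [g]
  | append_singleton fs f ih =>
    have h1 := (Sends.id fs).tensor (h f (by simp))
    have h2 := (ih fun f' hf' => h f' (by simp [hf'])).tensor (Sends.id [f])
    rw [List.length_append, List.length_singleton, slide_succ]
    rw [List.append_assoc] at h2 ⊢
    exact h1.comp h2

/-- What is computed from functions commuting with `g` commutes with `g`. -/
theorem commutes_of_sends {fs : List (App n)} {D : Arr} {f g : App n} (hf : Sends fs D [f])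
    (h : ∀ f' ∈ fs, Commutes f' g) : Commutes f g := by
  have h1 := hf.tensor (Sends.id [g])
  have h2 := (sends_slide fs g h).comp ((Sends.id [g]).tensor hf)
  rw [List.length_singleton, ← slide_natural D hf.dom_eq (b := 1) hf.cod_eq, slide_one] at h2
  exact h1.of_comp h2 rfl

/-- The function is deterministic and total: its value can be copied and discarded. -/
structure Classical (f : App n) : Prop where
  copy : Sends [f] (ζ 1 2 0) [f, f]
  discard : Sends [f] (ζ 1 0 0) []

theorem sends_copy_pair {f g : App n} (hf : Sends [f] (ζ 1 2 0) [f, f])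
    (hg : Sends [g] (ζ 1 2 0) [g, g]) (h : Commutes f g) :
    Sends [f, g] ((ζ 1 2 0 ⊗ ζ 1 2 0) * (𝟙 1 ⊗ of swap ⊗ 𝟙 1)) [f, g, f, g] :=
  (hf.tensor hg).comp (((Sends.id [f]).tensor h).tensor (Sends.id [g]))

/-- A gate that commutes with copying computes copyable values from copyable values. -/
theorem copy_of_sends {f g p : App n} {G : Arr} (hf : Sends [f] (ζ 1 2 0) [f, f])
    (hg : Sends [g] (ζ 1 2 0) [g, g]) (h : Commutes f g) (hp : Sends [f, g] G [p])
    (hG : G * ζ 1 2 0 = (ζ 1 2 0 ⊗ ζ 1 2 0) * (𝟙 1 ⊗ of swap ⊗ 𝟙 1) * (G ⊗ G)) :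
    Sends [p] (ζ 1 2 0) [p, p] := by
  refine hp.of_comp ?_ rfl
  rw [hG]
  exact (sends_copy_pair hf hg h).comp (hp.tensor hp)

/-! ### The parities -/

/-- The constant function with value `0`. -/
noncomputable def zeroFn : App n := post [] (χ 0 1 0) rfl

/-- The sum modulo two of two functions. -/
noncomputable def xorFn (f g : App n) : App n := post [f, g] (χ 2 1 0) rfl

theorem sends_zeroFn : Sends ([] : List (App n)) (χ 0 1 0) [zeroFn] := sends_post _ _ _ rfl

theorem sends_xorFn (f g : App n) : Sends [f, g] (χ 2 1 0) [xorFn f g] := sends_post _ _ _ rfl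

theorem classical_zeroFn : Classical (zeroFn : App n) where
  copy := by
    refine sends_zeroFn.of_comp ?_ rfl
    have h : χ 0 1 0 * ζ 1 2 0 = χ 0 1 0 ⊗ χ 0 1 0 := copy_state Colour.green (Or.inl rfl)
    rw [h]
    exact sends_zeroFn.tensor sends_zeroFn
  discard := by
    refine sends_zeroFn.of_comp ?_ rfl
    rw [state_mul_effect]
    exact Sends.id []

theorem classical_xorFn {f g : App n} (hf : Classical f) (hg : Classical g) (h : Commutes f g) :
    Classical (xorFn f g) where
  copy := copy_of_sends hf.copy hg.copy h (sends_xorFn f g) xor_copy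
  discard := by
    refine (sends_xorFn f g).of_comp ?_ rfl
    rw [xor_effect (Or.inl rfl)]
    exact hf.discard.tensor hg.discard

theorem xorFn_comm {f g : App n} (h : Commutes f g) : xorFn f g = xorFn g f := by
  refine (sends_xorFn f g).unique ?_
  have h1 : χ 2 1 0 = of swap * χ 2 1 0 := by
    simpa using (swap_mul_spider Colour.red 0 0 1 0).symm
  rw [h1]
  exact Sends.comp h (sends_xorFn g f)

theorem xorFn_assoc (f g h : App n) : xorFn (xorFn f g) h = xorFn f (xorFn g h) := by
  have h1 := ((sends_xorFn f g).tensor (Sends.id [h])).comp (sends_xorFn _ h)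
  have h2 := ((Sends.id [f]).tensor (sends_xorFn g h)).comp (sends_xorFn f _)
  have e1 := fusion_fst_in Colour.red 2 1 0 0
  have e2 := fusion_snd_in Colour.red 1 0
  rw [add_zero] at e1
  rw [List.length_singleton, e1] at h1
  rw [List.length_singleton, e2] at h2
  exact h1.unique h2

theorem zeroFn_xorFn (f : App n) : xorFn zeroFn f = f := by
  have h1 := (sends_zeroFn.tensor (Sends.id [f])).comp (sends_xorFn _ f)
  have e1 := fusion_fst_in Colour.red 0 1 0 0
  rw [add_zero, spider_one_one] at e1
  rw [List.length_singleton, e1] at h1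
  exact h1.unique (Sends.id [f])

/-- The function on `n + 1` lines that ignores the last line. -/
def up (f : App n) : App (n + 1) where
  arr := (f.arr ⊗ 𝟙 1) * (𝟙 n ⊗ of swap)
  dom_eq := by simp
  cod_eq := by simp

/-- The value of the last line. -/
noncomputable def lastFn (n : ℕ) : App (n + 1) where
  arr := 𝟙 n ⊗ ζ 1 2 0
  dom_eq := by simp
  cod_eq := by simp

/-- The new last line is moved back across the appended values. -/
theorem tuple_map_up (fs : List (App n)) :
    tuple (fs.map up) = (tuple fs ⊗ 𝟙 1) * (𝟙 n ⊗ sl fs.length) := by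
  induction fs using List.reverseRecOn with
  | nil => simp [one_tensor_one]
  | append_singleton fs f ih =>
    have e : (𝟙 n ⊗ of swap) * (tuple fs ⊗ 𝟙 2) =
        (tuple fs ⊗ 𝟙 2) * (𝟙 (n + fs.length) ⊗ of swap) := by
      rw [tensor_eq_left _ _ (by simp) (by simp), tensor_eq_right _ _ (by simp) (by simp)]
    rw [List.map_append, List.map_singleton, tuple_append, ih, tuple_singleton, tuple_append,
      tuple_singleton, List.length_singleton, List.length_append, List.length_singleton,
      slide_succ, up,
      mul_tensor_one, mul_tensor_one, one_tensor_mul, tensor_assoc (tuple fs), one_tensor_one,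
      mul_assoc, ← mul_assoc (𝟙 n ⊗ of swap), e, ← one_tensor_one n, tensor_assoc (𝟙 n),
      tensor_assoc (𝟙 n)]
    simp only [mul_assoc]

theorem Sends.map_up {fs gs : List (App n)} {D : Arr} (h : Sends fs D gs) :
    Sends (fs.map up) D (gs.map up) := by
  refine ⟨by simp [h.dom_eq], by simp [h.cod_eq], ?_⟩
  rw [tuple_map_up, tuple_map_up, ← h.eq, mul_tensor_one, mul_assoc, mul_assoc, tensor_assoc (𝟙 n),
    ← one_tensor_mul, slide_natural D h.dom_eq h.cod_eq, ← one_tensor_one, tensor_assoc,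
    ← one_tensor_mul]

/-- The value of one of the lines. -/
noncomputable def proj : (n : ℕ) → Fin n → App n
  | 0 => Fin.elim0
  | n + 1 => Fin.lastCases (lastFn n) fun i => up (proj n i)

@[simp] theorem proj_last (n : ℕ) : proj (n + 1) (Fin.last n) = lastFn n := by
  simp [proj]

@[simp] theorem proj_castSucc (n : ℕ) (i : Fin n) : proj (n + 1) i.castSucc = up (proj n i) := by
  simp [proj]

theorem copy_assoc : ζ 1 2 0 * (ζ 1 2 0 ⊗ 𝟙 1) = ζ 1 2 0 * (𝟙 1 ⊗ ζ 1 2 0) := by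
  have := fusion_snd_out Colour.green 1 2 0 0
  rw [add_zero] at this
  rw [fusion_fst_out, this]

theorem tuple_last_last : tuple [lastFn n, lastFn n] = 𝟙 n ⊗ ζ 1 3 0 := by
  rw [tuple, tuple_singleton, lastFn, List.length_singleton, tensor_assoc, ← one_tensor_mul,
    fusion_fst_out]

theorem classical_lastFn (n : ℕ) : Classical (lastFn n) where
  copy := by
    refine ⟨rfl, rfl, ?_⟩
    rw [tuple_last_last, tuple_singleton, lastFn, ← one_tensor_one, tensor_assoc, ← one_tensor_mul,
      ← copy_assoc, fusion_fst_out]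
  discard := by
    refine ⟨rfl, rfl, ?_⟩
    have := fusion_snd_out Colour.green 1 0 0 0
    rw [add_zero, add_zero, spider_one_one] at this
    rw [tuple_nil, tuple_singleton, lastFn, ← one_tensor_one, tensor_assoc, ← one_tensor_mul, this]

theorem commutes_last_last (n : ℕ) : Commutes (lastFn n) (lastFn n) := by
  refine ⟨rfl, rfl, ?_⟩
  have := spider_mul_swap Colour.green 1 1 0 0
  rw [tensor_zero] at this
  rw [tuple_last_last, ← one_tensor_one, tensor_assoc, ← one_tensor_mul]
  congr 1

theorem commutes_up_last (f : App n) : Commutes (up f) (lastFn n) := by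
  refine ⟨rfl, rfl, ?_⟩
  have h := slideInv_natural (a := 1) (b := 2) (ζ 1 2 0) rfl rfl
  rw [slideInv_one, slideInv, slideInv_one] at h
  have e : (𝟙 n ⊗ ζ 1 2 0) * (f.arr ⊗ 𝟙 2) = (f.arr ⊗ 𝟙 1) * (𝟙 n ⊗ (𝟙 1 ⊗ ζ 1 2 0)) := by
    rw [← tensor_assoc, one_tensor_one, tensor_eq_left _ _ (by simp) (by simp),
      tensor_eq_right _ _ (by simp) (by simp)]
  rw [tuple, tuple_singleton, tuple, tuple_singleton, List.length_singleton, up, lastFn,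
    List.length_singleton, ← one_tensor_one n 1, mul_tensor_one, tensor_assoc f.arr, one_tensor_one,
    ← mul_assoc, e]
  simp only [mul_assoc, tensor_assoc, ← one_tensor_mul]
  rw [← h]

theorem classical_proj (n : ℕ) (i : Fin n) : Classical (proj n i) := by
  induction n with
  | zero => exact i.elim0
  | succ n ih =>
    refine Fin.lastCases ?_ (fun i => ?_) i
    · rw [proj_last]; exact classical_lastFn n
    · rw [proj_castSucc]
      exact ⟨(ih i).copy.map_up, (ih i).discard.map_up⟩

theorem commutes_proj (n : ℕ) (i j : Fin n) : Commutes (proj n i) (proj n j) := by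
  induction n with
  | zero => exact i.elim0
  | succ n ih =>
    refine Fin.lastCases ?_ (fun i => ?_) i <;> refine Fin.lastCases ?_ (fun j => ?_) j
    · simpa using commutes_last_last n
    · simpa using (commutes_up_last _).symm
    · simpa using commutes_up_last _
    · rw [proj_castSucc, proj_castSucc]
      exact (ih i j).map_up

/-- The functions generated by the values of the lines and addition modulo two. -/
inductive IsParity : App n → Prop
  | zero : IsParity zeroFn
  | proj (i : Fin n) : IsParity (proj n i)
  | xor {f g : App n} : IsParity f → IsParity g → IsParity (xorFn f g)

theorem commutes_zeroFn (g : App n) : Commutes zeroFn g :=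
  commutes_of_sends sends_zeroFn (by simp)

theorem commutes_xorFn {f g h : App n} (hf : Commutes f h) (hg : Commutes g h) :
    Commutes (xorFn f g) h :=
  commutes_of_sends (sends_xorFn f g) (by simp [hf, hg])

theorem IsParity.commutes {f g : App n} (hf : IsParity f) (hg : IsParity g) : Commutes f g := by
  induction hf with
  | zero => exact commutes_zeroFn g
  | xor _ _ h1 h2 => exact commutes_xorFn h1 h2
  | proj i =>
    induction hg with
    | zero => exact (commutes_zeroFn _).symm
    | xor _ _ h1 h2 => exact (commutes_xorFn h1.symm h2.symm).symm
    | proj j => exact commutes_proj n i j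

theorem IsParity.classical {f : App n} (hf : IsParity f) : Classical f := by
  induction hf with
  | zero => exact classical_zeroFn
  | xor hf hg h1 h2 => exact classical_xorFn h1 h2 (hf.commutes hg)
  | proj i => exact classical_proj n i

/-- The parities of the lines. -/
@[ext]
structure Parity (n : ℕ) : Type where
  fn : App n
  isParity : IsParity fn

noncomputable instance : Zero (Parity n) := ⟨⟨zeroFn, IsParity.zero⟩⟩

noncomputable instance : Add (Parity n) := ⟨fun f g => ⟨xorFn f.1 g.1, IsParity.xor f.2 g.2⟩⟩

noncomputable instance : AddCommMonoid (Parity n) where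
  add_assoc f g h := Parity.ext (xorFn_assoc f.1 g.1 h.1)
  add_comm f g := Parity.ext (xorFn_comm (f.2.commutes g.2))
  zero_add f := Parity.ext (zeroFn_xorFn f.1)
  add_zero f := Parity.ext ((xorFn_comm (f.2.commutes IsParity.zero)).trans (zeroFn_xorFn f.1))
  nsmul := nsmulRec

/-! ### Effects on the values of functions -/

/-- The operation on `n` lines given by an effect on the values of functions. -/
def eff (fs : List (App n)) (E : Arr) : Arr := tuple fs * (𝟙 n ⊗ E)

@[simp] theorem eff_dom (fs : List (App n)) (E : Arr) : (eff fs E).dom = n := by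
  simp [eff]

theorem eff_cod (fs : List (App n)) {E : Arr} (hE : E.cod = 0) : (eff fs E).cod = n := by
  simp [eff, hE]

theorem Sends.eff {fs gs : List (App n)} {D : Arr} (h : Sends fs D gs) (E : Arr) :
    eff fs (D * E) = eff gs E := by
  rw [ZX.eff, ZX.eff, ← h.eq, one_tensor_mul, mul_assoc]

theorem eff_nil : eff ([] : List (App n)) (𝟙 0) = 𝟙 n := by
  simp [eff]

theorem eff_append (fs gs : List (App n)) {E E' : Arr} (hE : E.dom = fs.length)
    (hE' : E'.dom = gs.length) (hE0' : E'.cod = 0) :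
    eff (fs ++ gs) (E ⊗ E') = eff gs E' * eff fs E := by
  have e1 : (tuple fs ⊗ 𝟙 gs.length) * (𝟙 (n + fs.length) ⊗ E') =
      (𝟙 n ⊗ E') * (tuple fs ⊗ 𝟙 0) := by
    rw [tensor_eq_left _ _ (by simp) hE', tensor_eq_right _ _ (by simp) hE0']
  have e2 : E ⊗ E' = (𝟙 fs.length ⊗ E') * (E ⊗ 𝟙 0) := (tensor_eq_right _ _ hE hE0').symm
  rw [eff, eff, eff, tuple_append, e2, one_tensor_mul, tensor_zero, ← tensor_assoc, one_tensor_one,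
    ← mul_assoc, mul_assoc (tuple gs), e1, tensor_zero]
  simp only [mul_assoc]

/-- The phase `θ` on the value of a function. -/
noncomputable def phase (f : App n) (θ : Real.Angle) : Arr := eff [f] (ζ 1 0 θ)

@[simp] theorem phase_dom (f : App n) (θ : Real.Angle) : (phase f θ).dom = n := eff_dom _ _

@[simp] theorem phase_cod (f : App n) (θ : Real.Angle) : (phase f θ).cod = n := eff_cod _ rfl

theorem phase_mul_phase {f : App n} (hf : Classical f) (α β : Real.Angle) :
    phase f α * phase f β = phase f (α + β) := by
  have h := hf.copy.eff (ζ 1 0 β ⊗ ζ 1 0 α)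
  rw [copy_mul_effects] at h
  rw [add_comm, phase, phase, phase, h]
  exact (eff_append [f] [f] rfl rfl rfl).symm

theorem phase_zero {f : App n} (hf : Classical f) : phase f 0 = 𝟙 n := by
  have h := hf.discard.eff (𝟙 0)
  rw [mul_one' _ _ (by simp), eff_nil] at h
  exact h

theorem phase_comm {f g : App n} (h : Commutes f g) (α β : Real.Angle) :
    phase f α * phase g β = phase g β * phase f α := by
  have h1 := Sends.eff h (ζ 1 0 β ⊗ ζ 1 0 α)
  have h2 : of swap * (ζ 1 0 β ⊗ ζ 1 0 α) = ζ 1 0 α ⊗ ζ 1 0 β := by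
    have e1 := tensor_eq_right (ζ 1 0 β) (ζ 1 0 α) (m := 1) (n := 0) rfl rfl
    have e2 := tensor_eq_left (ζ 1 0 α) (ζ 1 0 β) (m := 0) (n := 1) rfl rfl
    have e3 := slide_natural (ζ 1 0 α) (a := 1) (b := 0) rfl rfl
    rw [tensor_zero] at e1
    rw [zero_tensor] at e2
    rw [slide_zero, slide_one, mul_one' _ _ (by simp)] at e3
    rw [← e1, ← e2, ← mul_assoc, e3]
  rw [h2] at h1
  have h3 := eff_append [g] [f] (E := ζ 1 0 β) (E' := ζ 1 0 α) rfl rfl rfl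
  have h4 := eff_append [f] [g] (E := ζ 1 0 α) (E' := ζ 1 0 β) rfl rfl rfl
  exact h3.symm.trans (h1.symm.trans h4)

/-! ### The legs of a gadget -/

/-- The selected elements of a finite family, in order. -/
def sel {α : Type*} : (k : ℕ) → (Fin k → α) → (Fin k → Bool) → List α
  | 0, _, _ => []
  | k + 1, x, s =>
      sel k (fun i => x i.castSucc) (fun i => s i.castSucc) ++
        bif s (Fin.last k) then [x (Fin.last k)] else []

theorem sel_map {α β : Type*} (g : α → β) (k : ℕ) (x : Fin k → α) (s : Fin k → Bool) :
    sel k (fun i => g (x i)) s = (sel k x s).map g := by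
  induction k with
  | zero => rfl
  | succ k ih =>
    rw [sel, sel, ih (fun i => x i.castSucc), List.map_append]
    cases s (Fin.last k) <;> simp

theorem sel_length {α : Type*} (k : ℕ) (x : Fin k → α) (s : Fin k → Bool) :
    (sel k x s).length = legCount k s := by
  induction k with
  | zero => rfl
  | succ k ih =>
    rw [sel, legCount, List.length_append, ih]
    cases s (Fin.last k) <;> simp

theorem mem_of_mem_sel {α : Type*} {k : ℕ} {x : Fin k → α} {s : Fin k → Bool} {a : α}
    (h : a ∈ sel k x s) : ∃ i, x i = a := by
  induction k with
  | zero => simp [sel] at h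
  | succ k ih =>
    rw [sel, List.mem_append] at h
    rcases h with h | h
    · obtain ⟨i, hi⟩ := ih h
      exact ⟨_, hi⟩
    · cases hs : s (Fin.last k) <;> simp [hs] at h
      exact ⟨_, h.symm⟩

theorem sel_sum {α : Type*} [AddCommMonoid α] (k : ℕ) (x : Fin k → α) (s : Fin k → Bool) :
    (sel k x s).sum = ∑ i, if s i = true then x i else 0 := by
  induction k with
  | zero => rfl
  | succ k ih =>
    rw [sel, List.sum_append, ih, Fin.sum_univ_castSucc]
    cases s (Fin.last k) <;> simp

theorem legs_succ (n : ℕ) (s : Fin (n + 1) → Bool) :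
    of (legs (n + 1) s) =
      (of (legs n fun i => s i.castSucc) ⊗ of (tap (s (Fin.last n)))) *
        (𝟙 n ⊗ sl (legCount n fun i => s i.castSucc) ⊗ 𝟙 (s (Fin.last n)).toNat) := by
  exact (of_comp _ _).trans (congrArg₂ _ (of_cast _ _ _) (of_cast _ _ _))

/-- The legs of a gadget carry the values of the selected lines. -/
theorem legs_eq_tuple (n : ℕ) (s : Fin n → Bool) : of (legs n s) = tuple (sel n (proj n) s) := by
  induction n with
  | zero => rfl
  | succ n ih =>
    have h1 : sel n (fun i => proj (n + 1) i.castSucc) (fun i => s i.castSucc) =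
        (sel n (proj n) fun i => s i.castSucc).map up := by
      rw [← sel_map]; simp
    rw [legs_succ, sel, ih, h1, tuple_append, tuple_map_up, sel_length, proj_last]
    cases s (Fin.last n)
    · have h2 : of (tap false) = 𝟙 1 := of_wire
      simp [h2]
    · have h2 : of (tap true) = ζ 1 2 0 := rfl
      rw [h2, mul_tensor_one, ← mul_assoc]
      congr 1
      simp only [cond_true, tuple_singleton, List.length_singleton]
      rw [tensor_assoc, one_tensor_one]
      exact (tensor_eq_right _ _ (by simp) rfl).symm

/-- The legs of a gadget on the values of functions carry copies of the selected values. -/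
theorem sends_legs (k : ℕ) (fs : Fin k → App n) (s : Fin k → Bool)
    (hf : ∀ i, Sends [fs i] (ζ 1 2 0) [fs i, fs i]) (hc : ∀ i j, Commutes (fs i) (fs j)) :
    Sends (List.ofFn fs) (of (legs k s)) (List.ofFn fs ++ sel k fs s) := by
  induction k with
  | zero => exact Sends.id []
  | succ k ih =>
    have h1 := ih (fun i => fs i.castSucc) (fun i => s i.castSucc) (fun i => hf _)
      (fun i j => hc _ _)
    have h2 : Sends [fs (Fin.last k)] (of (tap (s (Fin.last k))))
        ([fs (Fin.last k)] ++ bif s (Fin.last k) then [fs (Fin.last k)] else []) := by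
      cases s (Fin.last k)
      · have h2 : of (tap false) = 𝟙 1 := of_wire
        rw [h2]
        exact Sends.id _
      · exact hf _
    have h3 := sends_slide (sel k (fun i => fs i.castSucc) fun i => s i.castSucc) (fs (Fin.last k))
      (fun f hf => by
        obtain ⟨i, rfl⟩ := mem_of_mem_sel hf
        exact hc _ _)
    have h4 := ((Sends.id (List.ofFn fun i => fs i.castSucc)).tensor h3).tensor
      (Sends.id (bif s (Fin.last k) then [fs (Fin.last k)] else []))
    rw [List.length_ofFn, sel_length] at h4
    have h5 : (bif s (Fin.last k) then [fs (Fin.last k)] else []).length =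
        (s (Fin.last k)).toNat := by
      cases s (Fin.last k) <;> rfl
    rw [h5] at h4
    have h6 := h1.tensor h2
    rw [← List.append_assoc, List.append_assoc (List.ofFn _) (sel _ _ _)] at h6
    have h7 := h6.comp h4
    rw [← legs_succ] at h7
    rw [List.ofFn_succ', sel, List.concat_eq_append]
    simpa using h7

theorem sends_sum (L : List (Parity n)) :
    Sends (L.map Parity.fn) (χ L.length 1 0) [L.sum.1] := by
  induction L using List.reverseRecOn with
  | nil => exact sends_zeroFn
  | append_singleton L f ih =>
    have h := (ih.tensor (Sends.id [f.1])).comp (sends_xorFn L.sum.1 f.1)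
    rw [List.length_singleton, fusion_fst_in, add_zero] at h
    rw [List.map_append, List.sum_append, List.sum_singleton, List.length_append]
    exact h

/-- The value of a line, as a parity. -/
noncomputable def line (i : Fin n) : Parity n := ⟨proj n i, IsParity.proj i⟩

/-- A phase gadget is a phase on a parity. -/
theorem phaseGadget_eq (S : Finset (Fin n)) (θ : Real.Angle) :
    of (phaseGadget S θ) = phase (∑ i ∈ S, line i).1 θ := by
  have h1 := sends_sum (sel n (line (n := n)) fun i => decide (i ∈ S))
  have h2 : (sel n (line (n := n)) fun i => decide (i ∈ S)).sum = ∑ i ∈ S, line i := by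
    rw [sel_sum]
    simp
  rw [sel_length, ← sel_map, h2] at h1
  rw [phase, ← h1.eff, phaseGadget, of_comp, legs_eq_tuple]
  rfl

/-! ### Gadgets on the values of functions -/

/-- Applying `D` to the values of the functions `fs` amounts to applying `φ` to the lines. -/
def Pulls (fs : List (App n)) (D φ : Arr) : Prop :=
  tuple fs * (𝟙 n ⊗ D) = φ * tuple fs

namespace Pulls

variable {fs gs : List (App n)} {D E φ ψ : Arr}

theorem comp (h : Pulls fs D φ) (h' : Pulls fs E ψ) : Pulls fs (D * E) (φ * ψ) := by
  unfold Pulls at *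
  rw [one_tensor_mul, ← mul_assoc, h, mul_assoc, h', mul_assoc]

/-- The operation `φ` has to pass the functions `gs`, which are computed before `fs`. -/
theorem tensor (h : Pulls fs D φ) (h' : Pulls gs E ψ) (hD : D.dom = fs.length)
    (hE : E.dom = gs.length) (hE' : E.cod = gs.length)
    (hc : tuple gs * (φ ⊗ 𝟙 gs.length) = φ * tuple gs) : Pulls (fs ++ gs) (D ⊗ E) (ψ * φ) := by
  have e1 : (tuple fs ⊗ 𝟙 gs.length) * (𝟙 (n + fs.length) ⊗ E) =
      (𝟙 n ⊗ E) * (tuple fs ⊗ 𝟙 gs.length) := by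
    rw [tensor_eq_left _ _ (by simp) hE, tensor_eq_right _ _ (by simp) hE']
  have e2 : D ⊗ E = (𝟙 fs.length ⊗ E) * (D ⊗ 𝟙 gs.length) := (tensor_eq_right _ _ hD hE').symm
  unfold Pulls at *
  rw [tuple_append, e2, one_tensor_mul, ← tensor_assoc, ← tensor_assoc, one_tensor_one,
    ← mul_assoc, mul_assoc (tuple gs), e1, ← mul_assoc, h', mul_assoc, ← mul_tensor_one, h,
    mul_tensor_one, mul_assoc, ← mul_assoc (tuple gs), hc]
  simp only [mul_assoc]

/-- If the values of `fs` can be discarded by `E`, then `φ` is determined by `D`. -/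
theorem unique (h : Pulls fs D φ) (h' : Pulls fs D ψ) (hE : Sends fs E []) (hφ : φ.cod = n)
    (hψ : ψ.cod = n) : φ = ψ := by
  have e := congrArg (· * (𝟙 n ⊗ E)) (h.symm.trans h')
  simpa only [mul_assoc, hE.eq, tuple_nil, mul_one' n φ hφ, mul_one' n ψ hψ] using e

end Pulls

/-- An effect on values copied from those of `fs` is an operation on the lines. -/
theorem pulls_of_sends {fs gs : List (App n)} {D E : Arr} (h : Sends fs D (fs ++ gs))
    (hE : E.dom = gs.length) (hE0 : E.cod = 0) : Pulls fs (D * (𝟙 fs.length ⊗ E)) (eff gs E) := by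
  have e1 : (tuple fs ⊗ 𝟙 gs.length) * (𝟙 (n + fs.length) ⊗ E) =
      (𝟙 n ⊗ E) * (tuple fs ⊗ 𝟙 0) := by
    rw [tensor_eq_left _ _ (by simp) hE, tensor_eq_right _ _ (by simp) hE0]
  unfold Pulls
  rw [one_tensor_mul, ← mul_assoc, h.eq, tuple_append, ← tensor_assoc, one_tensor_one, mul_assoc,
    e1, tensor_zero, eff, mul_assoc]

theorem pulls_phase {f : App n} (hf : Sends [f] (ζ 1 2 0) [f, f]) (θ : Real.Angle) :
    Pulls [f] (ζ 1 1 θ) (phase f θ) := by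
  have h := pulls_of_sends (gs := [f]) (E := ζ 1 0 θ) hf rfl rfl
  rw [List.length_singleton, fusion_snd_out, zero_add, add_zero] at h
  exact h

/-- A phase on a function can be applied before or after computing functions that commute with
it. -/
theorem tuple_phase_comm {f : App n} (gs : List (App n)) (h : ∀ g ∈ gs, Commutes f g)
    (θ : Real.Angle) : tuple gs * (phase f θ ⊗ 𝟙 gs.length) = phase f θ * tuple gs := by
  induction gs with
  | nil => simp
  | cons g gs ih =>
    have h1 : g.arr * (phase f θ ⊗ 𝟙 1) = phase f θ * g.arr := by
      have hc := (h g (by simp)).symm.eq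
      have e1 := slideInv_natural (ζ 1 0 θ) (a := 1) (b := 0) rfl rfl
      rw [slideInv, slideInv_one, mul_one' 1 _ (by simp)] at e1
      have e2 : (g.arr ⊗ 𝟙 1) * (𝟙 (n + 1) ⊗ ζ 1 0 θ) = (𝟙 n ⊗ ζ 1 0 θ) * (g.arr ⊗ 𝟙 0) := by
        rw [tensor_eq_left _ _ (m := n + 1) (n := 1) g.cod_eq rfl,
          tensor_eq_right _ _ (m := n) (n := 0) g.dom_eq rfl]
      have e3 : tuple [f, g] = g.arr * (f.arr ⊗ 𝟙 1) := by
        rw [tuple, tuple_singleton]; rfl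
      have e4 : tuple [g, f] = f.arr * (g.arr ⊗ 𝟙 1) := by
        rw [tuple, tuple_singleton]; rfl
      rw [phase, eff, tuple_singleton, mul_tensor_one, tensor_assoc, ← mul_assoc, ← e3, ← hc,
        mul_assoc, ← one_tensor_mul, ← e1, e4, ← tensor_assoc, one_tensor_one, mul_assoc, e2,
        tensor_zero, mul_assoc]
    have h2 := ih fun g' hg' => h g' (by simp [hg'])
    rw [tuple, List.length_cons, add_comm gs.length, ← one_tensor_one, ← tensor_assoc, mul_assoc,
      ← mul_tensor_one, h1, mul_tensor_one, ← mul_assoc, h2, mul_assoc]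

/-- The phase `θ` on the conjunction of two functions. -/
noncomputable def phaseTwo (f g : App n) (θ : Real.Angle) : Arr :=
  eff [f, g] (of (and 2) * ζ 1 0 θ)

/-- The phase `θ` on the conjunction of three functions. -/
noncomputable def phaseThree (f g h : App n) (θ : Real.Angle) : Arr :=
  eff [f, g, h] (of (and 3) * ζ 1 0 θ)

theorem pulls_phaseGadget (f : Fin 3 → Parity n) (θ : Real.Angle) :
    Pulls (List.ofFn fun i => (f i).1) (of (phaseGadget (Finset.univ : Finset (Fin 3)) θ))
      (phase (f 0 + f 1 + f 2).1 θ) := by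
  have h1 := sends_legs 3 (fun i => (f i).1) (fun i => decide (i ∈ Finset.univ))
    (fun i => (f i).2.classical.copy) (fun i j => (f i).2.commutes (f j).2)
  have h2 := pulls_of_sends (E := χ 3 1 0 * ζ 1 0 θ) h1 rfl rfl
  have h3 := sends_sum [f 0, f 1, f 2]
  have h4 : [f 0, f 1, f 2].sum = f 0 + f 1 + f 2 := by simp [add_assoc]
  rw [h4] at h3
  rw [phase, ← h3.eff, phaseGadget, of_comp]
  exact h2

theorem pulls_phaseAnd (f : Fin 3 → Parity n) (S : Finset (Fin 3)) (θ : Real.Angle) :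
    Pulls (List.ofFn fun i => (f i).1) (of (phaseAnd S θ))
      (eff (sel 3 (fun i => (f i).1) fun i => decide (i ∈ S))
        (of (and (legCount 3 fun i => decide (i ∈ S))) * ζ 1 0 θ)) := by
  have h1 := sends_legs 3 (fun i => (f i).1) (fun i => decide (i ∈ S))
    (fun i => (f i).2.classical.copy) (fun i j => (f i).2.commutes (f j).2)
  rw [phaseAnd, of_comp]
  exact pulls_of_sends (E := of (and (legCount 3 fun i => decide (i ∈ S))) * ζ 1 0 θ) h1
    (by simp [sel_length]) rfl

/-- The decomposition of the phase on the sum of three parities into phases on conjunctions. -/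
theorem phase_add_add (f g h : Parity n) :
    phase (f + g + h).1 (-(Real.pi / 4 : ℝ) : Real.Angle) =
      phase h.1 (-(Real.pi / 4 : ℝ) : Real.Angle) *
        (phase g.1 (-(Real.pi / 4 : ℝ) : Real.Angle) *
          phase f.1 (-(Real.pi / 4 : ℝ) : Real.Angle)) *
        phaseTwo f.1 g.1 (Real.pi / 2 : ℝ) * phaseTwo f.1 h.1 (Real.pi / 2 : ℝ) *
        phaseTwo g.1 h.1 (Real.pi / 2 : ℝ) * phaseThree f.1 g.1 h.1 Real.pi := by
  set a : Real.Angle := -(Real.pi / 4 : ℝ) with ha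
  -- The phase `-π / 4` of the gadget corresponds to `α = π / 2` in the decomposition rule.
  set x : Fin 3 → Parity n := ![f, g, h]
  have e1 : ((-(Real.pi / 2) / 2 : ℝ) : Real.Angle) = a := by
    rw [ha, ← Real.Angle.coe_neg]; congr 1; ring
  have e2 : ((-2 * (Real.pi / 2) : ℝ) : Real.Angle) = (Real.pi : Real.Angle) := by
    rw [← Real.Angle.neg_coe_pi, ← Real.Angle.coe_neg]; congr 1; ring
  have hrule := of_eq.2 (Derivable.gadget_and (Real.pi / 2) (by positivity)
    (by linarith [Real.pi_pos]))
  rw [e1, e2, of_comp, of_comp, of_comp, of_comp] at hrule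
  have hL := pulls_phaseGadget x a
  have h01 := pulls_phaseAnd x {0, 1} (Real.pi / 2 : ℝ)
  have h02 := pulls_phaseAnd x {0, 2} (Real.pi / 2 : ℝ)
  have h12 := pulls_phaseAnd x {1, 2} (Real.pi / 2 : ℝ)
  have h012 := pulls_phaseAnd x Finset.univ (Real.pi : ℝ)
  have hfg : Pulls ([f.1] ++ [g.1]) (ζ 1 1 a ⊗ ζ 1 1 a) (phase g.1 a * phase f.1 a) :=
    (pulls_phase f.2.classical.copy a).tensor (pulls_phase g.2.classical.copy a) rfl rfl rfl
      (tuple_phase_comm [g.1] (by simpa using f.2.commutes g.2) a)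
  have hP : Pulls ([f.1] ++ [g.1] ++ [h.1]) (of (power (Z 1 1 a) 3))
      (phase h.1 a * (phase g.1 a * phase f.1 a)) := by
    have e : of (power (Z 1 1 a) 3) = ζ 1 1 a ⊗ ζ 1 1 a ⊗ ζ 1 1 a := by
      rw [power, of_tensor, power, of_tensor, power, of_tensor, power]
      change 𝟙 0 ⊗ _ ⊗ _ ⊗ _ = _
      rw [zero_tensor]; rfl
    have c1 := tuple_phase_comm [h.1] (by simpa using f.2.commutes h.2) a
    have c2 := tuple_phase_comm [h.1] (by simpa using g.2.commutes h.2) a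
    rw [e]
    refine hfg.tensor (pulls_phase h.2.classical.copy a) rfl rfl rfl ?_
    rw [mul_tensor_one, ← mul_assoc, c2, mul_assoc, c1, mul_assoc]
  have hR := (((hP.comp h01).comp h02).comp h12).comp h012
  rw [← hrule] at hR
  refine Pulls.unique (fs := [f.1, g.1, h.1]) (E := ζ 1 0 0 ⊗ ζ 1 0 0 ⊗ ζ 1 0 0) hL hR
    ((f.2.classical.discard.tensor g.2.classical.discard).tensor h.2.classical.discard)
    (phase_cod _ _) ?_
  rw [mul_cod]
  exact eff_cod _ rfl

theorem phaseTwo_zero (g : Parity n) (θ : Real.Angle) : phaseTwo zeroFn g.1 θ = 𝟙 n := by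
  have h1 := (sends_zeroFn.tensor (Sends.id [g.1])).eff (of (and 2) * ζ 1 0 θ)
  have h2 := g.2.classical.discard.eff (𝟙 0)
  rw [List.length_singleton, ← mul_assoc, and_two_zero, mul_assoc, state_mul_effect] at h1
  rw [eff_nil] at h2
  exact h1.symm.trans h2

theorem phaseThree_zero (g h : Parity n) (θ : Real.Angle) :
    phaseThree zeroFn g.1 h.1 θ = 𝟙 n := by
  have h1 := (sends_zeroFn.tensor (Sends.id [g.1, h.1])).eff (of (and 3) * ζ 1 0 θ)
  have h2 := (g.2.classical.discard.tensor h.2.classical.discard).eff (𝟙 0)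
  change eff _ ((χ 0 1 0 ⊗ 𝟙 2) * _) = _ at h1
  rw [← mul_assoc, and_three_zero, mul_assoc, state_mul_effect] at h1
  rw [List.append_nil, eff_nil] at h2
  exact h1.symm.trans h2

/-- The decomposition of the phase on the sum of two parities, obtained from that on the sum of
three parities by taking the first one to be `0`. -/
theorem phase_add (g h : Parity n) :
    phase (g + h).1 (-(Real.pi / 4 : ℝ) : Real.Angle) =
      phase h.1 (-(Real.pi / 4 : ℝ) : Real.Angle) *
        phase g.1 (-(Real.pi / 4 : ℝ) : Real.Angle) * phaseTwo g.1 h.1 (Real.pi / 2 : ℝ) := by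
  have e := phase_add_add 0 g h
  have e0 : ∀ θ, phase (0 : Parity n).1 θ = 𝟙 n := by
    intro θ
    have h1 := sends_zeroFn.eff (n := n) (ζ 1 0 θ)
    rw [state_mul_effect, eff_nil] at h1
    exact h1.symm
  have e1 : ∀ θ, phaseTwo (0 : Parity n).1 g.1 θ = 𝟙 n := phaseTwo_zero g
  have e2 : ∀ θ, phaseTwo (0 : Parity n).1 h.1 θ = 𝟙 n := phaseTwo_zero h
  have e3 : ∀ θ, phaseThree (0 : Parity n).1 g.1 h.1 θ = 𝟙 n := phaseThree_zero g h
  have e4 : (phaseTwo g.1 h.1 (Real.pi / 2 : ℝ)).cod = n := eff_cod _ rfl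
  rw [zero_add, e0, e1, e2, e3, mul_one' n (_ * phaseTwo _ _ _) e4] at e
  simpa using e

/-- The sign of a conjunction of three functions is additive in the first of them, since the
conjunction distributes over the sum. -/
theorem phaseThree_add (f f' g h : Parity n) :
    phaseThree (f + f').1 g.1 h.1 Real.pi =
      phaseThree f'.1 g.1 h.1 Real.pi * phaseThree f.1 g.1 h.1 Real.pi := by
  -- The conjunction of `g` and `h` is the common factor in the distributive law.
  set p : App n := post [g.1, h.1] (of (and 2)) rfl with hp
  have hp1 : Sends [g.1, h.1] (of (and 2)) [p] := sends_post _ _ _ rfl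
  have hcopy : Sends [p] (ζ 1 2 0) [p, p] :=
    copy_of_sends g.2.classical.copy h.2.classical.copy (g.2.commutes h.2) hp1 and_two_copy
  have hcomm : Commutes f'.1 p := by
    refine (commutes_of_sends hp1 ?_).symm
    simp [g.2.commutes f'.2, h.2.commutes f'.2]
  have hthree : ∀ k : App n, phaseThree k g.1 h.1 Real.pi =
      eff [k, p] (of (and 2) * ζ 1 0 (Real.pi : Real.Angle)) := by
    intro k
    rw [phaseThree, and_three_eq, mul_assoc]
    exact ((Sends.id [k]).tensor hp1).eff _
  have hxor : Sends [f.1, f'.1, p] (χ 2 1 0 ⊗ 𝟙 1) [(f + f').1, p] :=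
    (sends_xorFn f.1 f'.1).tensor (Sends.id [p])
  have hmid : Sends [f.1, f'.1, p] ((𝟙 2 ⊗ ζ 1 2 0) * (𝟙 1 ⊗ of swap ⊗ 𝟙 1))
      [f.1, p, f'.1, p] :=
    ((Sends.id [f.1, f'.1]).tensor hcopy).comp
      (((Sends.id [f.1]).tensor hcomm).tensor (Sends.id [p]))
  rw [hthree, hthree, hthree, ← hxor.eff, ← mul_assoc, and_two_xor, mul_assoc, mul_assoc,
    hmid.eff, xor_effect (Or.inr rfl), interchange _ _ _ _ rfl]
  exact eff_append [f.1, p] [f'.1, p] rfl rfl rfl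

/-! ### Polynomial functions of degree at most three -/

section Polarization

variable {P G ι : Type*} [AddCommMonoid P] [AddCommGroup G]

/-- The defect of additivity of `w` in the direction `a`. -/
def pol (w : P → G) (a f : P) : G := w (f + a) - w f - w a

theorem pol_zero {w : P → G} (h0 : w 0 = 0) (a : P) : pol w a 0 = 0 := by
  simp [pol, h0]

theorem add_eq_pol (w : P → G) (a f : P) : w (a + f) = w f + w a + pol w a f := by
  rw [pol, add_comm a f]; abel

/-- The third difference, in the form in which it arises from `phase_add_add`. -/
theorem neg_pol_pol (w : P → G) (f g h : P) :
    -w (f + g + h) - (-w h + (-w g + -w f) + -pol w g f + -pol w h f + -pol w h g) =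
      -pol (pol w h) g f := by
  simp only [pol]; abel

theorem neg_pol (w : P → G) (f g : P) : -w (f + g) - (-w g + -w f) = -pol w g f := by
  rw [pol]; abel

theorem sum_powersetCard_one (F : Finset ι → G) (S : Finset ι) :
    ∑ T ∈ S.powersetCard 1, F T = ∑ i ∈ S, F {i} := by
  rw [Finset.powersetCard_one, Finset.sum_map]
  rfl

theorem map_sum_of_additive {u : P → G} (h0 : u 0 = 0) (h : ∀ f g, u (f + g) = u f + u g)
    (x : ι → P) (S : Finset ι) : u (∑ i ∈ S, x i) = ∑ i ∈ S, u (x i) :=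
  map_sum (⟨⟨u, h0⟩, h⟩ : P →+ G) x S

variable [DecidableEq ι]

theorem sum_powersetCard_insert (F : Finset ι → G) {a : ι} {S : Finset ι} (ha : a ∉ S) (k : ℕ) :
    ∑ T ∈ (insert a S).powersetCard (k + 1), F T =
      ∑ T ∈ S.powersetCard (k + 1), F T + ∑ T ∈ S.powersetCard k, F (insert a T) := by
  have hT : ∀ (k : ℕ) (T : Finset ι), T ∈ S.powersetCard k → a ∉ T := fun k T h hT =>
    ha ((Finset.mem_powersetCard.1 h).1 hT)
  rw [Finset.powersetCard_succ_insert ha, Finset.sum_union, Finset.sum_image]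
  · intro T hT1 T' hT2 h
    rw [← Finset.erase_insert (hT k T hT1), ← Finset.erase_insert (hT k T' hT2), h]
  · rw [Finset.disjoint_left]
    intro T h1 h2
    obtain ⟨T', -, rfl⟩ := Finset.mem_image.1 h2
    exact hT _ _ h1 (Finset.mem_insert_self a T')

/-- A quadratic function is determined by its values at sums of at most two terms. -/
theorem map_sum_of_quadratic {u : P → G} (h0 : u 0 = 0)
    (h : ∀ a f g, pol u a (f + g) = pol u a f + pol u a g) (x : ι → P) (S : Finset ι) :
    u (∑ i ∈ S, x i) = (2 - S.card : ℤ) • ∑ i ∈ S, u (x i) +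
      ∑ T ∈ S.powersetCard 2, u (∑ i ∈ T, x i) := by
  induction S using Finset.induction_on with
  | empty =>
    have e (k : ℕ) : (∅ : Finset ι).powersetCard (k + 1) = ∅ :=
      Finset.powersetCard_eq_empty.2 (by simp)
    simp [h0, e]
  | insert a S ha ih =>
    have h1 := map_sum_of_additive (pol_zero h0 (x a)) (h (x a)) x S
    have h2 : ∑ i ∈ S, u (∑ j ∈ ({a, i} : Finset ι), x j) = ∑ i ∈ S, u (x i + x a) := by
      refine Finset.sum_congr rfl fun i hi => ?_
      rw [Finset.sum_pair (by rintro rfl; exact ha hi), add_comm]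
    rw [Finset.sum_insert ha, add_eq_pol u, h1, ih, Finset.sum_insert ha,
      Finset.card_insert_of_notMem ha, sum_powersetCard_insert _ ha, sum_powersetCard_one, h2]
    simp only [pol, Finset.sum_sub_distrib, Finset.sum_const, ← natCast_zsmul]
    push_cast
    module

/-- The coefficient `(m - 2) (m - 3) / 2` of the values at single terms, defined by recursion to
avoid a division. -/
def singleCoeff : ℕ → ℤ
  | 0 => 3
  | m + 1 => singleCoeff m + (m - 2)

theorem two_mul_singleCoeff (m : ℕ) : 2 * singleCoeff m = (m - 2) * (m - 3) := by
  induction m with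
  | zero => simp [singleCoeff]
  | succ m ih => rw [singleCoeff, mul_add, ih]; push_cast; ring

theorem two_mul_choose_two (m : ℕ) : (2 : ℤ) * (m.choose 2 : ℕ) = m * (m - 1) := by
  induction m with
  | zero => simp
  | succ m ih =>
    rw [Nat.choose_succ_succ' m 1]; push_cast; rw [mul_add, ih, Nat.choose_one_right]; ring

/-- The coefficient of the value at the new term when a term is added to a sum of `m` terms: one
from the term itself, the others from the single terms and the pairs in `map_sum_of_quadratic`. -/
theorem singleCoeff_succ (m : ℕ) : singleCoeff (m + 1) = 1 - (2 - m) * m - (m.choose 2 : ℕ) := by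
  have h1 := two_mul_singleCoeff (m + 1)
  have h2 := two_mul_choose_two m
  push_cast at h1
  linarith

/-- A cubic function is determined by its values at sums of at most three terms. -/
theorem map_sum_of_cubic {w : P → G} (h0 : w 0 = 0)
    (h : ∀ a b f g, pol (pol w a) b (f + g) = pol (pol w a) b f + pol (pol w a) b g) (x : ι → P)
    (S : Finset ι) :
    w (∑ i ∈ S, x i) = singleCoeff S.card • ∑ i ∈ S, w (x i) +
      (3 - S.card : ℤ) • ∑ T ∈ S.powersetCard 2, w (∑ i ∈ T, x i) +
      ∑ T ∈ S.powersetCard 3, w (∑ i ∈ T, x i) := by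
  induction S using Finset.induction_on with
  | empty =>
    have e (k : ℕ) : (∅ : Finset ι).powersetCard (k + 1) = ∅ :=
      Finset.powersetCard_eq_empty.2 (by simp)
    simp [h0, e]
  | insert a S ha ih =>
    have h1 := map_sum_of_quadratic (pol_zero h0 (x a)) (h (x a)) x S
    have h2 : ∑ i ∈ S, w (∑ j ∈ ({a, i} : Finset ι), x j) = ∑ i ∈ S, w (x i + x a) := by
      refine Finset.sum_congr rfl fun i hi => ?_
      rw [Finset.sum_pair (by rintro rfl; exact ha hi), add_comm]
    have h3 : ∑ T ∈ S.powersetCard 2, w (∑ j ∈ insert a T, x j) =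
        ∑ T ∈ S.powersetCard 2, w (∑ i ∈ T, x i + x a) := by
      refine Finset.sum_congr rfl fun T hT => ?_
      rw [Finset.sum_insert fun h => ha ((Finset.mem_powersetCard.1 hT).1 h), add_comm]
    have h4 : singleCoeff S.card = singleCoeff (S.card + 1) + (2 - S.card) := by
      rw [singleCoeff]; ring
    rw [Finset.sum_insert ha, add_eq_pol w, h1, ih, Finset.sum_insert ha,
      Finset.card_insert_of_notMem ha, sum_powersetCard_insert _ ha, sum_powersetCard_one,
      sum_powersetCard_insert _ ha, h2, h3, h4, singleCoeff_succ]
    simp only [pol, Finset.sum_sub_distrib, Finset.sum_const, ← natCast_zsmul,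
      Finset.card_powersetCard]
    push_cast
    module

end Polarization

/-! ### The group of phases on parities -/

/-- The diagrams `n → n`, up to derivable equality. -/
def Endo (n : ℕ) : Type := {f : Arr // f.dom = n ∧ f.cod = n}

instance : Monoid (Endo n) where
  mul f g := ⟨f.1 * g.1, f.2.1, g.2.2⟩
  one := ⟨𝟙 n, one_dom n, one_cod n⟩
  mul_assoc f g h := Subtype.ext (mul_assoc f.1 g.1 h.1)
  one_mul f := Subtype.ext (one_mul' n f.1 f.2.1)
  mul_one f := Subtype.ext (mul_one' n f.1 f.2.2)

/-- The phase `θ` on a parity, as an invertible operation on the lines. -/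
noncomputable def phaseUnit (f : Parity n) (θ : Real.Angle) : (Endo n)ˣ where
  val := ⟨phase f.fn θ, phase_dom _ _, phase_cod _ _⟩
  inv := ⟨phase f.fn (-θ), phase_dom _ _, phase_cod _ _⟩
  val_inv := Subtype.ext (by
    refine (phase_mul_phase f.isParity.classical θ (-θ)).trans ?_
    rw [add_neg_cancel, phase_zero f.isParity.classical]
    rfl)
  inv_val := Subtype.ext (by
    refine (phase_mul_phase f.isParity.classical (-θ) θ).trans ?_
    rw [neg_add_cancel, phase_zero f.isParity.classical]
    rfl)

/-- The group generated by the phases on parities. -/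
def phaseSubgroup (n : ℕ) : Subgroup (Endo n)ˣ :=
  Subgroup.closure (Set.range fun p : Parity n × Real.Angle => phaseUnit p.1 p.2)

instance : CommGroup (phaseSubgroup n) where
  mul_comm x y := by
    have h : IsMulCommutative (phaseSubgroup n) := Subgroup.isMulCommutative_closure <| by
      rintro _ ⟨⟨f, α⟩, rfl⟩ _ ⟨⟨g, β⟩, rfl⟩
      exact Units.ext (Subtype.ext (phase_comm (f.isParity.commutes g.isParity) α β))
    exact h.is_comm.comm x y

/-- The group generated by the phases on parities, written additively. -/
abbrev PhaseGroup (n : ℕ) : Type := Additive (phaseSubgroup n)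

/-- The operation on the lines given by an element of the group. -/
def PhaseGroup.arr (x : PhaseGroup n) : Arr := x.toMul.1.1.1

theorem PhaseGroup.arr_add (x y : PhaseGroup n) : (x + y).arr = x.arr * y.arr := rfl

theorem PhaseGroup.arr_zero : (0 : PhaseGroup n).arr = 𝟙 n := rfl

theorem PhaseGroup.arr_injective {x y : PhaseGroup n} (h : x.arr = y.arr) : x = y :=
  Additive.toMul.injective (Subtype.ext (Units.ext (Subtype.ext h)))

theorem PhaseGroup.eq_arr_sub {x y : PhaseGroup n} {E : Arr} (hE : E.dom = n)
    (h : x.arr = y.arr * E) : E = (x - y).arr := by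
  rw [sub_eq_add_neg, add_comm, arr_add, h, ← mul_assoc, ← arr_add, neg_add_cancel, arr_zero,
    one_mul' n E hE]

/-- The phases on a parity, as a homomorphism from the angles. -/
noncomputable def phaseHom (f : Parity n) : Real.Angle →+ PhaseGroup n where
  toFun θ := Additive.ofMul ⟨phaseUnit f θ, Subgroup.subset_closure ⟨(f, θ), rfl⟩⟩
  map_zero' := PhaseGroup.arr_injective (phase_zero f.isParity.classical)
  map_add' α β :=
    PhaseGroup.arr_injective (phase_mul_phase f.isParity.classical α β).symm

theorem arr_phaseHom (f : Parity n) (θ : Real.Angle) : (phaseHom f θ).arr = phase f.fn θ := rfl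

theorem phaseHom_zero (θ : Real.Angle) : phaseHom (0 : Parity n) θ = 0 := by
  apply PhaseGroup.arr_injective
  have h1 := sends_zeroFn.eff (n := n) (ζ 1 0 θ)
  rw [state_mul_effect, eff_nil] at h1
  exact h1.symm

/-- The phase `π / 4` on a parity. -/
noncomputable def quarter (f : Parity n) : PhaseGroup n := phaseHom f (Real.pi / 4 : ℝ)

theorem arr_neg_quarter (f : Parity n) :
    phase f.fn (-(Real.pi / 4 : ℝ) : Real.Angle) = (-quarter f).arr := by
  rw [quarter, ← map_neg, arr_phaseHom]

/-- The phase `π / 2` on a conjunction is minus the second difference of `quarter`. -/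
theorem phaseTwo_eq (f g : Parity n) :
    phaseTwo f.fn g.fn (Real.pi / 2 : ℝ) = (-pol quarter g f).arr := by
  have h := phase_add f g
  rw [arr_neg_quarter, arr_neg_quarter, arr_neg_quarter, ← PhaseGroup.arr_add] at h
  rw [← neg_pol]
  exact PhaseGroup.eq_arr_sub (eff_dom _ _) h

/-- The phase `π` on a conjunction is minus the third difference of `quarter`. -/
theorem phaseThree_eq (f g h : Parity n) :
    phaseThree f.fn g.fn h.fn Real.pi = (-pol (pol quarter h) g f).arr := by
  have e := phase_add_add f g h
  rw [phaseTwo_eq, phaseTwo_eq, phaseTwo_eq, arr_neg_quarter, arr_neg_quarter, arr_neg_quarter,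
    arr_neg_quarter] at e
  simp only [← PhaseGroup.arr_add] at e
  rw [← neg_pol_pol]
  exact PhaseGroup.eq_arr_sub (eff_dom _ _) e

/-- The fourth difference of `quarter` vanishes: `quarter` is a cubic function. -/
theorem pol_pol_quarter_add (a b f g : Parity n) :
    pol (pol quarter a) b (f + g) = pol (pol quarter a) b f + pol (pol quarter a) b g := by
  have h := phaseThree_add f g b a
  rw [phaseThree_eq (f + g) b a, phaseThree_eq f b a, phaseThree_eq g b a,
    ← PhaseGroup.arr_add] at h
  have h' := neg_injective ((PhaseGroup.arr_injective h).trans (neg_add _ _).symm)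
  rw [h', add_comm]

/-! ### The gadgets -/

/-- A sequence of gadgets is a sum in the group of phases, so that its order is irrelevant. -/
theorem sequence_eq (θ : Finset (Fin n) → Real.Angle) (L : List (Finset (Fin n))) :
    of (sequence (L.map fun S => phaseGadget S (θ S))) =
      (L.map fun S => phaseHom (∑ i ∈ S, line i) (θ S)).sum.arr := by
  induction L with
  | nil => rfl
  | cons S L ih =>
    rw [List.map_cons, List.map_cons, List.sum_cons, PhaseGroup.arr_add, ← ih, arr_phaseHom,
      ← phaseGadget_eq]
    exact of_comp _ _

theorem phaseHom_gadgetPhase_one (f : Parity n) :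
    phaseHom f (gadgetPhase n 1 : Real.Angle) = singleCoeff n • quarter f := by
  have h1 : (2 : ℝ) * singleCoeff n = (n - 2) * (n - 3) := by
    exact_mod_cast two_mul_singleCoeff n
  have h2 : gadgetPhase n 1 = singleCoeff n * (Real.pi / 4) := by
    rw [gadgetPhase]; linear_combination (-Real.pi / 8) * h1
  rw [h2, Real.Angle.intCast_mul_eq_zsmul, map_zsmul, quarter]

theorem phaseHom_gadgetPhase_two (f : Parity n) :
    phaseHom f (gadgetPhase n 2 : Real.Angle) = (3 - n : ℤ) • quarter f := by
  have h2 : gadgetPhase n 2 = (3 - n : ℤ) * (Real.pi / 4) := by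
    rw [gadgetPhase]; push_cast; ring
  rw [h2, Real.Angle.intCast_mul_eq_zsmul, map_zsmul, quarter]

end ZX

theorem mainTheorem2 (n : ℕ) (hn : 3 ≤ n) (L : List (Finset (Fin n))) (hL : L.Nodup)
    (hmem : ∀ S : Finset (Fin n), S ∈ L ↔ S.card = 1 ∨ S.card = 2 ∨ S.card = 3) :
    ZX.Derivable
      (ZX.Diagram.phaseGadget (Finset.univ : Finset (Fin n)) ((Real.pi / 4 : ℝ) : Real.Angle))
      (ZX.Diagram.sequence
        (L.map fun S => ZX.Diagram.phaseGadget S (ZX.gadgetPhase n S.card : Real.Angle))) := by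
  rw [← ZX.Arr.of_eq, ZX.phaseGadget_eq, ZX.sequence_eq, ← ZX.arr_phaseHom]
  congr 1
  have hset : L.toFinset = (Finset.univ : Finset (Fin n)).powersetCard 1 ∪
      (Finset.univ.powersetCard 2 ∪ Finset.univ.powersetCard 3) := by
    ext S
    simp [hmem, Finset.mem_powersetCard]
  have hdisj : ∀ {j k : ℕ}, j ≠ k → Disjoint ((Finset.univ : Finset (Fin n)).powersetCard j)
      (Finset.univ.powersetCard k) := fun h => Finset.pairwise_disjoint_powersetCard _ h
  rw [← List.sum_toFinset _ hL, hset, Finset.sum_union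
      (Finset.disjoint_union_right.2 ⟨hdisj (by norm_num), hdisj (by norm_num)⟩),
    Finset.sum_union (hdisj (by norm_num))]
  have hcard : ∀ {k : ℕ} {u : ZX.Parity n → ZX.PhaseGroup n},
      (∀ f, ZX.phaseHom f (ZX.gadgetPhase n k : Real.Angle) = u f) →
      ∑ S ∈ (Finset.univ : Finset (Fin n)).powersetCard k,
        ZX.phaseHom (∑ i ∈ S, ZX.line i) (ZX.gadgetPhase n S.card : Real.Angle) =
      ∑ S ∈ (Finset.univ : Finset (Fin n)).powersetCard k, u (∑ i ∈ S, ZX.line i) := by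
    intro k u hu
    refine Finset.sum_congr rfl fun S hS => ?_
    rw [(Finset.mem_powersetCard.1 hS).2, hu]
  rw [hcard ZX.phaseHom_gadgetPhase_one, hcard ZX.phaseHom_gadgetPhase_two,
    hcard (k := 3) (u := ZX.quarter) fun f => rfl, ← Finset.smul_sum, ← Finset.smul_sum,
    ZX.sum_powersetCard_one, ← add_assoc]
  have hcubic := ZX.map_sum_of_cubic (w := ZX.quarter) (ZX.phaseHom_zero _) ZX.pol_pol_quarter_add
    (ZX.line (n := n)) Finset.univ
  rw [Finset.card_univ, Fintype.card_fin] at hcubic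
  simp only [Finset.sum_singleton]
  exact hcubic
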